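/- Let $\mathbb F_q$ be a finite field of odd order $q$ in which $3$ is a square, let $t\in\mathbb F_q$, $t\neq 0$, and put $S_t=\{x\in\mathbb F_q^2: x_1^2+x_2^2=t\}$; we also write $S_t$ for its indicator function. For functions $f_1,\dots,f_4:\mathbb F_q^2\to[0,\infty)$ define the form of the graph $C_4$ + diagonal $$\diamondsuit_t(f_1,f_2,f_3,f_4)=\frac{1}{q^2|S_t|}\sum_{x^1,x^2,x^3,x^4\in\mathbb F_q^2}S_t(x^1-x^2)S_t(x^2-x^3)S_t(x^3-x^4)S_t(x^4-x^1)S_t(x^1-x^3)\prod_{i=1}^4 f_i(x^i)$$ and the form of the graph $K_3$ + tail (the kite) $$\unlhd(f_1,f_2,f_3,f_4)=\frac{1}{q^2|S_t|^2}\sum_{x^1,x^2,x^3,x^4\in\mathbb F_q^2}S_t(x^1-x^2)S_t(x^2-x^3)S_t(x^3-x^4)S_t(x^3-x^1)\prod_{i=1}^4 f_i(x^i).$$ Let $\|f\|_p=\big(q^{-2}\sum_{x\in\mathbb F_q^2}|f(x)|^p\big)^{1/p}$ for $1\le p<\infty$ and $\|f\|_\infty=\max_{x\in\mathbb F_q^2}|f(x)|$.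 For $1\le p_1,\dots,p_4\le\infty$ (real numbers or $\infty$) let $\diamondsuit_t(p_1,p_2,p_3,p_4)$ and $\unlhd(p_1,p_2,p_3,p_4)$ be the smallest constants $C$ for which, respectively, $\diamondsuit_t(f_1,\dots,f_4)\le C\prod_{i=1}^4\|f_i\|_{p_i}$ and $\unlhd(f_1,\dots,f_4)\le C\prod_{i=1}^4\|f_i\|_{p_i}$ hold for all non-negative real-valued functions $f_1,\dots,f_4$ on $\mathbb F_q^2$. Fix any family of pairs $(\mathbb F_q,t)$ as above (for instance, all such pairs). Write $\lesssim 1$ if the quantity is bounded by a finite constant that is the same for all pairs of the family. Write $\unlhd(p_1,p_2,p_3,p_4)\lessapprox 1$ if there is a constant $C$, the same for all pairs of the family, such that $\unlhd(1_{E_1},1_{E_2},1_{E_3},1_{E_4})\le C\prod_{i=1}^4\|1_{E_i}\|_{p_i}$ for all subsets $E_1,\dots,E_4\subseteq\mathbb F_q^2$. **Theorem.** Let $1\le p_1,p_2,p_3,p_4\le\infty$. If $\diamondsuit_t(p_1,p_2,p_3,p_4)\lesssim 1$ and $(p_1,p_2,p_3,p_4)\ne(2,2,2,\infty)$, then $\unlhd(p_1,p_2,p_3,p_4)\lesssim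 1$. In addition, $\unlhd(2,2,2,\infty)\lessapprox 1$. -/

import Mathlib

open scoped ENNReal NNReal

noncomputable section

namespace GraphForms

/-- The plane `F²` over a field `F`. -/
abbrev Plane (F : Type*) : Type _ := Fin 2 → F

/-- The circle `S_t = {x ∈ F² : x₁² + x₂² = t}`. -/
def circle {F : Type*} [Field F] (t : F) : Set (Plane F) :=
  {x | x 0 ^ 2 + x 1 ^ 2 = t}

/-- The indicator function of the circle `S_t`. -/
def circleInd {F : Type*} [Field F] (t : F) : Plane F → ℝ :=
  (circle t).indicator 1

/-- The `L^p` norm on `F²` with respect to the normalized counting measure: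
`(q⁻² ∑ |f x|^p)^(1/p)` for `p < ∞`, and the maximum of `|f|` for `p = ∞`. -/
def normL {F : Type*} [Fintype F] (p : ℝ≥0∞) (f : Plane F → ℝ) : ℝ :=
  if p = ∞ then ⨆ x, |f x|
  else (((Fintype.card F : ℝ) ^ 2)⁻¹ * ∑ x, |f x| ^ p.toReal) ^ (1 / p.toReal)

/-- The form of the graph `C₄` + diagonal on `F²`: vertices `1, 2, 3, 4`, edges
`12, 23, 34, 41` and the diagonal `13`. In the plane, the normalizing factor is `q² |S_t|`. -/
def diamondForm {F : Type*} [Field F] [Fintype F] (t : F) (f : Fin 4 → Plane F → ℝ) : ℝ :=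
  1 / ((Fintype.card F : ℝ) ^ 2 * ((circle t).ncard : ℝ)) *
    ∑ x₁ : Plane F, ∑ x₂ : Plane F, ∑ x₃ : Plane F, ∑ x₄ : Plane F,
      circleInd t (x₁ - x₂) * circleInd t (x₂ - x₃) * circleInd t (x₃ - x₄) *
        circleInd t (x₄ - x₁) * circleInd t (x₁ - x₃) *
        (f 0 x₁ * f 1 x₂ * f 2 x₃ * f 3 x₄)

/-- The form of the kite (`K₃` + tail) on `F²`: the triangle `123` with the tail `34` attached
at the vertex `3`. In the plane, the normalizing factor is `q² |S_t|²`. -/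
def kiteForm {F : Type*} [Field F] [Fintype F] (t : F) (f : Fin 4 → Plane F → ℝ) : ℝ :=
  1 / ((Fintype.card F : ℝ) ^ 2 * ((circle t).ncard : ℝ) ^ 2) *
    ∑ x₁ : Plane F, ∑ x₂ : Plane F, ∑ x₃ : Plane F, ∑ x₄ : Plane F,
      circleInd t (x₁ - x₂) * circleInd t (x₂ - x₃) * circleInd t (x₃ - x₄) *
        circleInd t (x₃ - x₁) *
        (f 0 x₁ * f 1 x₂ * f 2 x₃ * f 3 x₄)

/-- `Λ(f₁, …, f₄) ≤ C ∏ ‖f_j‖_{p_j}` for all non-negative real-valued functions `f_j` on `F²`. -/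
def StrongBound {F : Type*} [Fintype F] (Λ : (Fin 4 → Plane F → ℝ) → ℝ)
    (p : Fin 4 → ℝ≥0∞) (C : ℝ≥0) : Prop :=
  ∀ f : Fin 4 → Plane F → ℝ, (∀ j x, 0 ≤ f j x) → Λ f ≤ C * ∏ j, normL (p j) (f j)

/-- `Λ(E₁, …, E₄) ≤ C ∏ ‖E_j‖_{p_j}` for all subsets `E_j` of `F²`, which are identified with
their indicator functions. -/
def RestrictedBound {F : Type*} [Fintype F] (Λ : (Fin 4 → Plane F → ℝ) → ℝ)
    (p : Fin 4 → ℝ≥0∞) (C : ℝ≥0) : Prop :=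
  ∀ E : Fin 4 → Set (Plane F),
    Λ (fun j => (E j).indicator 1) ≤ C * ∏ j, normL (p j) ((E j).indicator 1)

/-- The best constant `Λ(p₁, …, p₄)` in the strong-type inequality (`∞` if there is none). -/
def bestConst {F : Type*} [Fintype F] (Λ : (Fin 4 → Plane F → ℝ) → ℝ)
    (p : Fin 4 → ℝ≥0∞) : ℝ≥0∞ :=
  ⨅ (C : ℝ≥0) (_ : StrongBound Λ p C), (C : ℝ≥0∞)

/-- `c ≲ 1`: the quantities `c i` of a family are bounded by one finite constant. -/
def LesssimOne {ι : Type*} (c : ι → ℝ≥0∞) : Prop :=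
  ∃ C : ℝ≥0, 1 ≤ C ∧ ∀ i, c i ≤ C

lemma normL_nonneg {F : Type*} [Fintype F] (p : ℝ≥0∞) (f : Plane F → ℝ) : 0 ≤ normL p f := by
  unfold normL
  split_ifs
  · exact Real.iSup_nonneg fun x => abs_nonneg _
  · positivity

/-- The best constant is attained: it is at most `C` exactly if the inequality holds with `C`. -/
lemma bestConst_le_iff {F : Type*} [Fintype F] (Λ : (Fin 4 → Plane F → ℝ) → ℝ)
    (p : Fin 4 → ℝ≥0∞) (C : ℝ≥0) : bestConst Λ p ≤ C ↔ StrongBound Λ p C := by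
  refine ⟨fun h f hf => ?_, fun h => iInf₂_le C h⟩
  have hP : 0 ≤ ∏ j, normL (p j) (f j) := Finset.prod_nonneg fun j _ => normL_nonneg _ _
  have key : ∀ ε : ℝ, 0 < ε → Λ f ≤ (C + ε) * ∏ j, normL (p j) (f j) := by
    intro ε hε
    have hlt : bestConst Λ p < ((C + ⟨ε, hε.le⟩ : ℝ≥0) : ℝ≥0∞) :=
      h.trans_lt (ENNReal.coe_lt_coe.2 (lt_add_of_pos_right C hε))
    unfold bestConst at hlt
    simp only [iInf_lt_iff] at hlt
    obtain ⟨D, hD, hDC⟩ := hlt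
    have h1 : (D : ℝ) ≤ C + ε := by
      have := (ENNReal.coe_lt_coe.1 hDC).le
      exact_mod_cast this
    exact (hD f hf).trans (mul_le_mul_of_nonneg_right h1 hP)
  refine le_of_forall_pos_le_add fun δ hδ => ?_
  have h2 := key (δ / (1 + ∏ j, normL (p j) (f j))) (by positivity)
  have h3 : δ / (1 + ∏ j, normL (p j) (f j)) * ∏ j, normL (p j) (f j) ≤ δ := by
    rw [div_mul_eq_mul_div, div_le_iff₀ (by positivity)]
    nlinarith
  linarith [add_mul (C : ℝ) (δ / (1 + ∏ j, normL (p j) (f j))) (∏ j, normL (p j) (f j))]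

end GraphForms

end

/-!
Write `a j = 1 / p j`. Up to the normalization of the norms, an `L^p` bound for the form of a graph
says that its sum over `∏ F j ^ a j` is bounded whenever the functions `F j ≥ 1` have a given mass,
and the exponents `a` with this property form a convex lower set. The graph of the circle is sparse:
all degrees are of order `q`, and two points have at most two common neighbours, as two circles meet
in at most two points. For such a kernel the bounds at the vertices of the polytope
`a i + ∑ j, a j ≤ 2` hold for the triangle and for the path with two edges. Summing out the tail, or
the vertex `1`, reduces the kite to a triangle or to a path; so its exponents contain the convex
hull of these two cases, which is `a 0 + ∑ a ≤ 2`, `a 2 + ∑ a ≤ 2`, `a 1 + a 3 + ∑ a ≤ 2`.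

These are exactly the conditions obtained by testing the diamond form on circles and their centre,
up to an error: a diamond bound with constant `C` gives `(q / 2) ^ (L - 2) ≤ 4 C`, where `L` is the
largest of the three left hand sides. Scaling `a` by `2 / L` costs only a power of that quantity in
the kite bound. If `3` is not a square, the circle graph has no triangles and the kite form
vanishes.
-/

namespace GraphForms

/-! ### Weighted forms and their exponents -/

section WeightedForm

variable {κ V : Type*} [Fintype κ] [DecidableEq κ] [Fintype V]

/-- The multilinear form `∑ₓ W(x) ∏ⱼ fⱼ(xⱼ)` of a weight `W` on the maps `x` from the vertices `κ`
of a graph to `V`. The forms of graphs have as weight a product over the edges. -/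
def weightedForm (W : (κ → V) → ℝ) (f : κ → V → ℝ) : ℝ :=
  ∑ x, W x * ∏ j, f j (x j)

lemma weightedForm_mono {W : (κ → V) → ℝ} (hW : ∀ x, 0 ≤ W x) {f g : κ → V → ℝ}
    (hf : ∀ j x, 0 ≤ f j x) (hfg : ∀ j x, f j x ≤ g j x) :
    weightedForm W f ≤ weightedForm W g :=
  Finset.sum_le_sum fun x _ => mul_le_mul_of_nonneg_left
    (Finset.prod_le_prod (fun j _ => hf j (x j)) fun j _ => hfg j (x j)) (hW x)

lemma weightedForm_mul (W : (κ → V) → ℝ) (c : κ → ℝ) (f : κ → V → ℝ) :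
    weightedForm W (fun j x => c j * f j x) = (∏ j, c j) * weightedForm W f := by
  simp only [weightedForm, Finset.prod_mul_distrib, Finset.mul_sum]
  exact Finset.sum_congr rfl fun x _ => mul_left_comm _ _ _

lemma card_le_weightedForm_indicator {W : (κ → V) → ℝ} (hW : ∀ x, 0 ≤ W x) (E : κ → Set V)
    (s : Finset (κ → V)) (hs : ∀ x ∈ s, 1 ≤ W x ∧ ∀ j, x j ∈ E j) :
    (s.card : ℝ) ≤ weightedForm W fun j => (E j).indicator 1 := by
  have hE : ∀ x : κ → V, 0 ≤ ∏ j, (E j).indicator (1 : V → ℝ) (x j) := fun x =>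
    Finset.prod_nonneg fun j _ => Set.indicator_nonneg (fun _ _ => zero_le_one) _
  calc (s.card : ℝ) = ∑ x ∈ s, 1 := by simp
    _ ≤ ∑ x ∈ s, W x * ∏ j, (E j).indicator (1 : V → ℝ) (x j) := by
      refine Finset.sum_le_sum fun x hx => ?_
      have hprod : ∏ j, (E j).indicator (1 : V → ℝ) (x j) = 1 :=
        Finset.prod_eq_one fun j _ => Set.indicator_of_mem ((hs x hx).2 j) _
      rw [hprod, mul_one]
      exact (hs x hx).1
    _ ≤ weightedForm W fun j => (E j).indicator 1 :=
      Finset.sum_le_univ_sum_of_nonneg fun x => mul_nonneg (hW x) (hE x)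

/-- The exponents `a` for which `∑ₓ W(x) ∏ⱼ Fⱼ(xⱼ)^aⱼ ≤ B` whenever each `Fⱼ ≥ 1` has sum at most
`M`. Such a bound is an `L^p` inequality with `pⱼ = 1 / aⱼ`; the normalization `Fⱼ ≥ 1` makes the
set of exponents a lower set. -/
def boundedExponents (W : (κ → V) → ℝ) (M B : ℝ) : Set (κ → ℝ) :=
  {a | ∀ F : κ → V → ℝ, (∀ j x, 1 ≤ F j x) → (∀ j, ∑ x, F j x ≤ M) →
    weightedForm W (fun j x => F j x ^ a j) ≤ B}

lemma boundedExponents_mono (W : (κ → V) → ℝ) (M : ℝ) {B C : ℝ} (hBC : B ≤ C) :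
    boundedExponents W M B ⊆ boundedExponents W M C :=
  fun _ ha F hF hM => (ha F hF hM).trans hBC

lemma isLowerSet_boundedExponents {W : (κ → V) → ℝ} (hW : ∀ x, 0 ≤ W x) (M B : ℝ) :
    IsLowerSet (boundedExponents W M B) := fun _ _ hab ha F hF hM =>
  (weightedForm_mono hW (fun j x => Real.rpow_nonneg (zero_le_one.trans (hF j x)) _)
    fun j x => Real.rpow_le_rpow_of_exponent_le (hF j x) (hab j)).trans (ha F hF hM)

lemma convex_boundedExponents {W : (κ → V) → ℝ} (hW : ∀ x, 0 ≤ W x) (M B : ℝ) :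
    Convex ℝ (boundedExponents W M B) := by
  intro a ha b hb s t hs ht hst F hF hM
  have hF0 : ∀ j x, 0 < F j x := fun j x => zero_lt_one.trans_le (hF j x)
  have hsplit : ∀ x : κ → V, ∏ j, F j (x j) ^ (s • a + t • b) j =
      (∏ j, F j (x j) ^ a j) ^ s * (∏ j, F j (x j) ^ b j) ^ t := by
    intro x
    rw [← Real.finsetProd_rpow _ _ fun j _ => Real.rpow_nonneg (hF0 j _).le _,
      ← Real.finsetProd_rpow _ _ fun j _ => Real.rpow_nonneg (hF0 j _).le _,
      ← Finset.prod_mul_distrib]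
    refine Finset.prod_congr rfl fun j _ => ?_
    rw [← Real.rpow_mul (hF0 j _).le, ← Real.rpow_mul (hF0 j _).le, ← Real.rpow_add (hF0 j _)]
    simp only [Pi.add_apply, Pi.smul_apply, smul_eq_mul, mul_comm]
  have hnonneg : ∀ (c : κ → ℝ) (x : κ → V), 0 ≤ ∏ j, F j (x j) ^ c j := fun c x =>
    Finset.prod_nonneg fun j _ => Real.rpow_nonneg (hF0 j _).le _
  calc weightedForm W (fun j x => F j x ^ (s • a + t • b) j)
      ≤ ∑ x, W x * (s * ∏ j, F j (x j) ^ a j + t * ∏ j, F j (x j) ^ b j) :=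
        Finset.sum_le_sum fun x _ => mul_le_mul_of_nonneg_left
          ((hsplit x).trans_le (Real.geom_mean_le_arith_mean2_weighted hs ht
            (hnonneg a x) (hnonneg b x) hst)) (hW x)
    _ = s * weightedForm W (fun j x => F j x ^ a j) +
        t * weightedForm W (fun j x => F j x ^ b j) := by
      simp only [weightedForm, Finset.mul_sum, ← Finset.sum_add_distrib]
      exact Finset.sum_congr rfl fun x _ => by ring
    _ ≤ s * B + t * B := add_le_add (mul_le_mul_of_nonneg_left (ha F hF hM) hs)
      (mul_le_mul_of_nonneg_left (hb F hF hM) ht)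
    _ = B := by rw [← add_mul, hst, one_mul]

lemma add_mem_boundedExponents {W : (κ → V) → ℝ} (hW : ∀ x, 0 ≤ W x) {M B : ℝ} (hM : 0 ≤ M)
    {a c : κ → ℝ} (ha : a ∈ boundedExponents W M B) (hc : ∀ j, 0 ≤ c j) :
    a + c ∈ boundedExponents W M (B * M ^ ∑ j, c j) := by
  intro F hF hFM
  have hF0 : ∀ j x, 0 < F j x := fun j x => zero_lt_one.trans_le (hF j x)
  have hle : ∀ j x, F j x ≤ M := fun j x =>
    (Finset.single_le_sum (fun y _ => (hF0 j y).le) (Finset.mem_univ x)).trans (hFM j)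
  calc weightedForm W (fun j x => F j x ^ (a + c) j)
      ≤ weightedForm W (fun j x => M ^ c j * F j x ^ a j) := by
        refine weightedForm_mono hW (fun j x => Real.rpow_nonneg (hF0 j x).le _) fun j x => ?_
        rw [Pi.add_apply, Real.rpow_add (hF0 j x), mul_comm]
        exact mul_le_mul_of_nonneg_right (Real.rpow_le_rpow (hF0 j x).le (hle j x) (hc j))
          (Real.rpow_nonneg (hF0 j x).le _)
    _ = M ^ (∑ j, c j) * weightedForm W (fun j x => F j x ^ a j) := by
        rw [weightedForm_mul, Real.rpow_sum_of_nonneg hM fun j _ => hc j]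
    _ ≤ M ^ (∑ j, c j) * B :=
        mul_le_mul_of_nonneg_left (ha F hF hFM) (Real.rpow_nonneg hM _)
    _ = B * M ^ ∑ j, c j := mul_comm _ _

end WeightedForm

lemma insertNth_zero_mem_boundedExponents {V : Type*} [Fintype V] {m : ℕ}
    {W : (Fin (m + 1) → V) → ℝ} {W' : (Fin m → V) → ℝ} {j : Fin (m + 1)} {D M B : ℝ} (hD : 0 ≤ D)
    (hW : ∀ y, ∑ v, W (j.insertNth v y) ≤ D * W' y) {a : Fin m → ℝ}
    (ha : a ∈ boundedExponents W' M B) :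
    j.insertNth 0 a ∈ boundedExponents W M (D * B) := by
  intro F hF hM
  set G : Fin m → V → ℝ := fun i => F (j.succAbove i) with hG
  have hG0 : ∀ y : Fin m → V, 0 ≤ ∏ i, G i (y i) ^ a i := fun y =>
    Finset.prod_nonneg fun i _ => Real.rpow_nonneg (zero_le_one.trans (hF _ _)) _
  calc weightedForm W (fun i x => F i x ^ (j.insertNth 0 a : Fin (m + 1) → ℝ) i)
      = ∑ y : Fin m → V, (∑ v, W (j.insertNth v y)) * ∏ i, G i (y i) ^ a i := by
        rw [weightedForm, ← (Fin.insertNthEquiv (fun _ => V) j).sum_comp,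
          Fintype.sum_prod_type_right]
        simp only [Fin.insertNthEquiv_apply, Fin.prod_univ_succAbove _ j, Fin.insertNth_apply_same,
          Fin.insertNth_apply_succAbove, Real.rpow_zero, one_mul, Finset.sum_mul, hG]
        rfl
    _ ≤ ∑ y, D * W' y * ∏ i, G i (y i) ^ a i :=
        Finset.sum_le_sum fun y _ => mul_le_mul_of_nonneg_right (hW y) (hG0 y)
    _ = D * weightedForm W' (fun i x => G i x ^ a i) := by
        simp only [weightedForm, Finset.mul_sum, mul_assoc]
    _ ≤ D * B := mul_le_mul_of_nonneg_left
        (ha G (fun _ => hF _) fun _ => hM _) hD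

/-- If `aᵢ ≤ aⱼ ≤ aₖ`, then `a` is a convex combination of `eₖ`, `2/3 (eⱼ + eₖ)`, `1/2 (1, 1, 1)`
and `0`. -/
lemma mem_of_add_sum_le_two {G : Set (Fin 3 → ℝ)} (hG : Convex ℝ G) (hzero : 0 ∈ G)
    (hsingle : ∀ k, Pi.single k 1 ∈ G) (hedge : ∀ i, Function.update (fun _ => 2 / 3) i 0 ∈ G)
    (hhalf : (fun _ => 1 / 2) ∈ G) {a : Fin 3 → ℝ} (ha : ∀ i, 0 ≤ a i)
    (hsum : ∀ i, a i + ∑ j, a j ≤ 2) : a ∈ G := by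
  set σ : Equiv.Perm (Fin 3) := Tuple.sort a
  have h01 : a (σ 0) ≤ a (σ 1) := Tuple.monotone_sort a (by decide)
  have h12 : a (σ 1) ≤ a (σ 2) := Tuple.monotone_sort a (by decide)
  have hσ : a (σ 0) + a (σ 1) + 2 * a (σ 2) ≤ 2 := by
    have h := hsum (σ 2)
    rw [← Equiv.sum_comp σ a, Fin.sum_univ_three] at h
    linarith
  set w : Fin 4 → ℝ := ![a (σ 2) - a (σ 1), 3 / 2 * (a (σ 1) - a (σ 0)), 2 * a (σ 0),
    1 - (a (σ 0) + a (σ 1) + 2 * a (σ 2)) / 2] with hw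
  set v : Fin 4 → Fin 3 → ℝ := ![Pi.single (σ 2) 1, Function.update (fun _ => 2 / 3) (σ 0) 0,
    fun _ => 1 / 2, 0] with hv
  have hmem : ∑ i, w i • v i ∈ G := by
    refine hG.sum_mem (fun i _ => ?_) ?_ fun i _ => ?_
    · fin_cases i <;> simp [hw] <;> linarith [ha (σ 0)]
    · simp only [hw, Fin.sum_univ_four, Matrix.cons_val]
      ring
    · fin_cases i
      exacts [hsingle _, hedge _, hhalf, hzero]
  convert hmem using 1
  refine funext fun j => ?_
  obtain ⟨i, rfl⟩ := σ.surjective j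
  fin_cases i <;>
    simp [hw, hv, Fin.sum_univ_four, σ.injective.eq_iff] <;>
    ring

/-! ### Sparse kernels -/

/-- A symmetric kernel with degrees at most `2 n`, in which any two distinct points have at most two
common neighbours. -/
structure SparseKernel {V : Type*} [Fintype V] (e : V → V → ℝ) (n : ℝ) : Prop where
  pos : 0 < n
  nonneg : ∀ x y, 0 ≤ e x y
  le_one : ∀ x y, e x y ≤ 1
  symm : ∀ x y, e x y = e y x
  self : ∀ x, e x x = 0
  degree : ∀ x, ∑ y, e x y ≤ 2 * n
  codegree : ∀ x y, x ≠ y → ∑ z, e x z * e y z ≤ 2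

lemma sum_mul_sq_pow_three_le {α : Type*} (s : Finset α) {w a : α → ℝ} (hw : ∀ x ∈ s, 0 ≤ w x)
    (ha : ∀ x ∈ s, 0 ≤ a x) :
    (∑ x ∈ s, w x * a x ^ 2) ^ 3 ≤ (∑ x ∈ s, w x) * (∑ x ∈ s, w x * a x ^ 3) ^ 2 := by
  have hwa : ∀ k : ℕ, ∀ x ∈ s, 0 ≤ w x * a x ^ k := fun k x hx =>
    mul_nonneg (hw x hx) (pow_nonneg (ha x hx) k)
  set R := ∑ x ∈ s, w x * a x ^ 2
  set T := ∑ x ∈ s, w x * a x ^ 3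
  set Q := ∑ x ∈ s, w x * a x ^ 1
  have hR : R ^ 2 ≤ Q * T := Finset.sum_sq_le_sum_mul_sum_of_sq_le_mul s (hwa 1) (hwa 3)
    fun x _ => le_of_eq (by ring)
  have hQ : Q ^ 2 ≤ (∑ x ∈ s, w x) * R := Finset.sum_sq_le_sum_mul_sum_of_sq_le_mul s hw (hwa 2)
    fun x _ => le_of_eq (by ring)
  have hR0 : 0 ≤ R := Finset.sum_nonneg (hwa 2)
  rcases hR0.eq_or_lt with hR0 | hR0
  · rw [← hR0, zero_pow three_ne_zero]
    exact mul_nonneg (Finset.sum_nonneg hw) (sq_nonneg T)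
  · refine le_of_mul_le_mul_right ?_ hR0
    calc R ^ 3 * R = (R ^ 2) ^ 2 := by ring
      _ ≤ (Q * T) ^ 2 := pow_le_pow_left₀ (sq_nonneg R) hR 2
      _ = Q ^ 2 * T ^ 2 := mul_pow Q T 2
      _ ≤ (∑ x ∈ s, w x) * R * T ^ 2 := mul_le_mul_of_nonneg_right hQ (sq_nonneg T)
      _ = (∑ x ∈ s, w x) * T ^ 2 * R := by ring

section Finset

variable {α : Type*} [DecidableEq α]

lemma sum_sq_add_sum_mul_sum_erase (s : Finset α) (b : α → ℝ) :
    ∑ x ∈ s, b x ^ 2 + ∑ x ∈ s, b x * ∑ y ∈ s.erase x, b y = (∑ x ∈ s, b x) ^ 2 := by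
  rw [← Finset.sum_add_distrib, sq, Finset.sum_mul]
  refine Finset.sum_congr rfl fun x hx => ?_
  rw [← Finset.add_sum_erase s b hx]
  ring

lemma exists_sq_sum_erase_le {s : Finset α} (hs : s.Nonempty) {b : α → ℝ}
    (hb : ∀ x ∈ s, 0 ≤ b x) :
    ∃ m ∈ s, (∑ x ∈ s.erase m, b x) ^ 2 ≤ ∑ x ∈ s, b x * ∑ y ∈ s.erase x, b y := by
  obtain ⟨m, hm, hmax⟩ := s.exists_max_image b hs
  have herase : ∀ x ∈ s, ∑ y ∈ s.erase m, b y ≤ ∑ y ∈ s.erase x, b y := by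
    intro x hx
    linarith [hmax x hx, s.add_sum_erase b hx, s.add_sum_erase b hm]
  refine ⟨m, hm, ?_⟩
  calc (∑ x ∈ s.erase m, b x) ^ 2
      ≤ (∑ x ∈ s, b x) * ∑ y ∈ s.erase m, b y := by
        rw [sq]
        refine mul_le_mul_of_nonneg_right ?_
          (Finset.sum_nonneg fun y hy => hb y (Finset.mem_of_mem_erase hy))
        linarith [s.add_sum_erase b hm, hb m hm]
    _ ≤ ∑ x ∈ s, b x * ∑ y ∈ s.erase x, b y := by
        rw [Finset.sum_mul]
        exact Finset.sum_le_sum fun x hx => mul_le_mul_of_nonneg_left (herase x hx) (hb x hx)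

lemma sum_mul_sq_pow_three_le_of_le_one (s : Finset α) {w a : α → ℝ} (hw : ∀ x ∈ s, 0 ≤ w x)
    (hw1 : ∀ x ∈ s, w x ≤ 1) (ha : ∀ x ∈ s, 0 ≤ a x) :
    (∑ x ∈ s, w x * a x ^ 2) ^ 3 ≤ 4 * (∑ x ∈ s, (w x * a x ^ 3) ^ 2 +
      (∑ x ∈ s, w x) * ∑ x ∈ s, w x * a x ^ 3 * ∑ y ∈ s.erase x, w y * a y ^ 3) := by
  rcases s.eq_empty_or_nonempty with rfl | hs
  · simp
  have hwa : ∀ k : ℕ, ∀ x ∈ s, 0 ≤ w x * a x ^ k := fun k x hx =>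
    mul_nonneg (hw x hx) (pow_nonneg (ha x hx) k)
  obtain ⟨m, hm, hrest⟩ := exists_sq_sum_erase_le hs (hwa 3)
  have hpeak : (w m * a m ^ 2) ^ 3 ≤ ∑ x ∈ s, (w x * a x ^ 3) ^ 2 :=
    calc (w m * a m ^ 2) ^ 3 = w m * (w m * a m ^ 3) ^ 2 := by ring
      _ ≤ (w m * a m ^ 3) ^ 2 := mul_le_of_le_one_left (sq_nonneg _) (hw1 m hm)
      _ ≤ ∑ x ∈ s, (w x * a x ^ 3) ^ 2 :=
        Finset.single_le_sum (f := fun x => (w x * a x ^ 3) ^ 2) (fun x _ => sq_nonneg _) hm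
  have htail : (∑ x ∈ s.erase m, w x * a x ^ 2) ^ 3 ≤
      (∑ x ∈ s, w x) * ∑ x ∈ s, w x * a x ^ 3 * ∑ y ∈ s.erase x, w y * a y ^ 3 :=
    (sum_mul_sq_pow_three_le (s.erase m) (fun x hx => hw x (Finset.mem_of_mem_erase hx))
      fun x hx => ha x (Finset.mem_of_mem_erase hx)).trans <|
    mul_le_mul (Finset.sum_le_sum_of_subset_of_nonneg (s.erase_subset m) fun x hx _ => hw x hx)
      hrest (sq_nonneg _) (Finset.sum_nonneg hw)
  rw [← s.add_sum_erase _ hm]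
  refine (add_pow_le (hwa 2 m hm)
    (Finset.sum_nonneg fun x hx => hwa 2 x (Finset.mem_of_mem_erase hx)) 3).trans ?_
  norm_num
  linarith

end Finset

namespace SparseKernel

variable {V : Type*} [Fintype V] {e : V → V → ℝ} {n : ℝ}

lemma degree' (h : SparseKernel e n) (y : V) : ∑ x, e x y ≤ 2 * n := by
  simpa only [h.symm _ y] using h.degree y

lemma sum_mul_mul_le (h : SparseKernel e n) (x y : V) :
    ∑ z, e x z * e y z * e x y ≤ 2 * e x y := by
  rw [← Finset.sum_mul]
  rcases eq_or_ne x y with rfl | hxy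
  · simp [h.self]
  · exact mul_le_mul_of_nonneg_right (h.codegree x y hxy) (h.nonneg x y)

lemma sum_sum_mul_sum_erase_le [DecidableEq V] (h : SparseKernel e n) {f : V → ℝ}
    (hf : ∀ x, 0 ≤ f x) :
    ∑ z, ∑ x, e z x * f x * ∑ y ∈ Finset.univ.erase x, e z y * f y ≤ 2 * (∑ x, f x) ^ 2 := by
  calc ∑ z, ∑ x, e z x * f x * ∑ y ∈ Finset.univ.erase x, e z y * f y
      = ∑ x, ∑ y ∈ Finset.univ.erase x, (∑ z, e x z * e y z) * (f x * f y) := by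
        rw [Finset.sum_comm]
        refine Finset.sum_congr rfl fun x _ => ?_
        simp only [Finset.mul_sum, Finset.sum_mul]
        rw [Finset.sum_comm]
        refine Finset.sum_congr rfl fun y _ => Finset.sum_congr rfl fun z _ => ?_
        rw [h.symm z x, h.symm z y]
        ring
    _ ≤ ∑ x, ∑ y ∈ Finset.univ.erase x, 2 * (f x * f y) :=
        Finset.sum_le_sum fun x _ => Finset.sum_le_sum fun y hy => mul_le_mul_of_nonneg_right
          (h.codegree x y (Finset.ne_of_mem_erase hy).symm) (mul_nonneg (hf x) (hf y))
    _ ≤ ∑ x, ∑ y, 2 * (f x * f y) :=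
        Finset.sum_le_sum fun x _ => Finset.sum_le_univ_sum_of_nonneg
          fun y => mul_nonneg zero_le_two (mul_nonneg (hf x) (hf y))
    _ = 2 * (∑ x, f x) ^ 2 := by
        simp only [← Finset.mul_sum, ← Finset.sum_mul, sq]

/-- The averaging operator of the kernel is bounded from `L^(3/2)` to `L³`. -/
lemma sum_pow_three_le (h : SparseKernel e n) {a : V → ℝ} (ha : ∀ x, 0 ≤ a x) :
    ∑ z, (∑ x, e z x * a x ^ 2) ^ 3 ≤ 24 * n * (∑ x, a x ^ 3) ^ 2 := by
  classical
  have ha3 : ∀ x, 0 ≤ a x ^ 3 := fun x => pow_nonneg (ha x) 3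
  have hdiag : ∑ z, ∑ x, (e z x * a x ^ 3) ^ 2 ≤ 2 * n * (∑ x, a x ^ 3) ^ 2 :=
    calc ∑ z, ∑ x, (e z x * a x ^ 3) ^ 2 ≤ ∑ z, ∑ x, e z x * (a x ^ 3) ^ 2 := by
          refine Finset.sum_le_sum fun z _ => Finset.sum_le_sum fun x _ => ?_
          rw [mul_pow]
          exact mul_le_mul_of_nonneg_right
            (pow_le_of_le_one (h.nonneg z x) (h.le_one z x) two_ne_zero) (sq_nonneg _)
      _ = ∑ x, (∑ z, e z x) * (a x ^ 3) ^ 2 := by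
          rw [Finset.sum_comm]
          simp only [Finset.sum_mul]
      _ ≤ ∑ x, 2 * n * (a x ^ 3) ^ 2 := Finset.sum_le_sum fun x _ =>
          mul_le_mul_of_nonneg_right (h.degree' x) (sq_nonneg _)
      _ ≤ 2 * n * (∑ x, a x ^ 3) ^ 2 := by
          rw [← Finset.mul_sum]
          exact mul_le_mul_of_nonneg_left (Finset.sum_sq_le_sq_sum_of_nonneg fun x _ => ha3 x)
            (mul_nonneg zero_le_two h.pos.le)
  have hoff : ∑ z, (∑ x, e z x) *
      ∑ x, e z x * a x ^ 3 * ∑ y ∈ Finset.univ.erase x, e z y * a y ^ 3 ≤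
        2 * n * (2 * (∑ x, a x ^ 3) ^ 2) := by
    refine (Finset.sum_le_sum fun z _ => mul_le_mul_of_nonneg_right (h.degree z) ?_).trans ?_
    · exact Finset.sum_nonneg fun x _ => mul_nonneg (mul_nonneg (h.nonneg z x) (ha3 x))
        (Finset.sum_nonneg fun y _ => mul_nonneg (h.nonneg z y) (ha3 y))
    · rw [← Finset.mul_sum]
      exact mul_le_mul_of_nonneg_left (h.sum_sum_mul_sum_erase_le ha3)
        (mul_nonneg zero_le_two h.pos.le)
  refine (Finset.sum_le_sum fun z _ => sum_mul_sq_pow_three_le_of_le_one Finset.univ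
    (fun x _ => h.nonneg z x) (fun x _ => h.le_one z x) fun x _ => ha x).trans ?_
  rw [← Finset.mul_sum, Finset.sum_add_distrib]
  linarith

end SparseKernel

lemma sum_rotate {V : Type*} [Fintype V] (φ : V → V → V → ℝ) :
    ∑ x, ∑ y, ∑ z, φ y z x = ∑ x, ∑ y, ∑ z, φ x y z := by
  rw [Finset.sum_comm]
  exact Finset.sum_congr rfl fun y _ => Finset.sum_comm

lemma mul_mul_le_sum_mul_min {p q r : ℝ} (hp : 0 ≤ p) (hq : 0 ≤ q) (hr : 0 ≤ r) :
    p * q * r ≤ p * q * min p q + q * r * min q r + r * p * min r p := by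
  have hpq : 0 ≤ p * q * min p q := mul_nonneg (mul_nonneg hp hq) (le_min hp hq)
  have hqr : 0 ≤ q * r * min q r := mul_nonneg (mul_nonneg hq hr) (le_min hq hr)
  have hrp : 0 ≤ r * p * min r p := mul_nonneg (mul_nonneg hr hp) (le_min hr hp)
  rcases le_or_gt r (min p q) with h | h
  · linarith [mul_le_mul_of_nonneg_left h (mul_nonneg hp hq)]
  rcases le_or_gt p (min q r) with h' | h'
  · linarith [mul_le_mul_of_nonneg_left h' (mul_nonneg hq hr)]
  · have h'' : q ≤ min r p := by grind
    linarith [mul_le_mul_of_nonneg_left h'' (mul_nonneg hr hp)]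

namespace SparseKernel

variable {V : Type*} [Fintype V] {e : V → V → ℝ} {n : ℝ}

lemma sum_sq_sum_mul_min_le (h : SparseKernel e n) {g : V → ℝ} (hg : ∀ x, 0 ≤ g x) :
    ∑ x, (∑ y, e x y * (g y * min (g x) (g y))) ^ 2 ≤ 3 * (∑ x, g x ^ 2) ^ 2 := by
  classical
  have hterm : ∀ x y, 0 ≤ e x y * (g y * min (g x) (g y)) := fun x y =>
    mul_nonneg (h.nonneg x y) (mul_nonneg (hg y) (le_min (hg x) (hg y)))
  have hterm_le : ∀ x y, e x y * (g y * min (g x) (g y)) ≤ e x y * g y ^ 2 := by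
    intro x y
    rw [sq]
    exact mul_le_mul_of_nonneg_left (mul_le_mul_of_nonneg_left (min_le_right _ _) (hg y))
      (h.nonneg x y)
  have hdiag : ∑ x, ∑ y, (e x y * (g y * min (g x) (g y))) ^ 2 ≤ (∑ x, g x ^ 2) ^ 2 := by
    rw [sq (∑ x, g x ^ 2), Finset.sum_mul_sum]
    refine Finset.sum_le_sum fun x _ => Finset.sum_le_sum fun y _ => ?_
    calc (e x y * (g y * min (g x) (g y))) ^ 2 ≤ (1 * (g y * g x)) ^ 2 :=
          pow_le_pow_left₀ (hterm x y) (mul_le_mul (h.le_one x y)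
            (mul_le_mul_of_nonneg_left (min_le_left _ _) (hg y))
            (mul_nonneg (hg y) (le_min (hg x) (hg y))) zero_le_one) 2
      _ = g x ^ 2 * g y ^ 2 := by ring
  have hoff : ∑ x, ∑ y, e x y * (g y * min (g x) (g y)) *
      ∑ z ∈ Finset.univ.erase y, e x z * (g z * min (g x) (g z)) ≤ 2 * (∑ x, g x ^ 2) ^ 2 := by
    refine le_trans ?_ (h.sum_sum_mul_sum_erase_le fun x => sq_nonneg (g x))
    exact Finset.sum_le_sum fun x _ => Finset.sum_le_sum fun y _ => mul_le_mul (hterm_le x y)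
      (Finset.sum_le_sum fun z _ => hterm_le x z) (Finset.sum_nonneg fun z _ => hterm x z)
      (mul_nonneg (h.nonneg x y) (sq_nonneg _))
  simp only [← sum_sq_add_sum_mul_sum_erase Finset.univ fun y => e _ y * (g y * min (g _) (g y)),
    Finset.sum_add_distrib]
  linarith

lemma sq_sum_mul_mul_min_le (h : SparseKernel e n) {g : V → ℝ} (hg : ∀ x, 0 ≤ g x) :
    (∑ x, ∑ y, e x y * (g x * g y * min (g x) (g y))) ^ 2 ≤ 3 * (∑ x, g x ^ 2) ^ 3 :=
  calc (∑ x, ∑ y, e x y * (g x * g y * min (g x) (g y))) ^ 2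
      = (∑ x, g x * ∑ y, e x y * (g y * min (g x) (g y))) ^ 2 := by
        simp only [Finset.mul_sum]
        simp only [mul_assoc, mul_left_comm (g _) (e _ _)]
    _ ≤ (∑ x, g x ^ 2) * ∑ x, (∑ y, e x y * (g y * min (g x) (g y))) ^ 2 :=
        Finset.sum_mul_sq_le_sq_mul_sq _ _ _
    _ ≤ (∑ x, g x ^ 2) * (3 * (∑ x, g x ^ 2) ^ 2) :=
        mul_le_mul_of_nonneg_left (h.sum_sq_sum_mul_min_le hg)
          (Finset.sum_nonneg fun x _ => sq_nonneg _)
    _ = 3 * (∑ x, g x ^ 2) ^ 3 := by ring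

lemma sum_triangle_mul_le (h : SparseKernel e n) {m : V → V → ℝ} (hm : ∀ x y, 0 ≤ m x y) :
    ∑ x, ∑ y, ∑ z, e x y * e y z * e z x * m x y ≤ 2 * ∑ x, ∑ y, e x y * m x y := by
  simp only [← Finset.sum_mul, Finset.mul_sum, ← mul_assoc]
  refine Finset.sum_le_sum fun x _ => Finset.sum_le_sum fun y _ =>
    mul_le_mul_of_nonneg_right (le_of_eq_of_le ?_ (h.sum_mul_mul_le x y)) (hm x y)
  refine Finset.sum_congr rfl fun z _ => ?_
  rw [h.symm x z]
  ring

/-- In `g x * g y * g z` the smallest factor may be replaced by the smaller one of the other two,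
and then the sum over the corresponding vertex of the triangle is at most `2`. -/
lemma sum_triangle_le (h : SparseKernel e n) {g : V → ℝ} (hg : ∀ x, 0 ≤ g x) :
    ∑ x, ∑ y, ∑ z, e x y * e y z * e z x * (g x * g y * g z) ≤
      6 * ∑ x, ∑ y, e x y * (g x * g y * min (g x) (g y)) := by
  set T : V → V → V → ℝ := fun x y z => e x y * e y z * e z x with hT
  set m : V → V → ℝ := fun x y => g x * g y * min (g x) (g y)
  have hm : ∀ x y, 0 ≤ m x y := fun x y =>
    mul_nonneg (mul_nonneg (hg x) (hg y)) (le_min (hg x) (hg y))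
  have hTrot : ∀ x y z, T x y z = T y z x := fun x y z => by simp only [hT]; ring
  have hrot : ∑ x, ∑ y, ∑ z, T x y z * m y z = ∑ x, ∑ y, ∑ z, T x y z * m x y := by
    simpa only [← hTrot] using sum_rotate fun x y z => T x y z * m x y
  have hrot' : ∑ x, ∑ y, ∑ z, T x y z * m z x = ∑ x, ∑ y, ∑ z, T x y z * m y z := by
    simpa only [← hTrot] using sum_rotate fun x y z => T x y z * m y z
  calc ∑ x, ∑ y, ∑ z, T x y z * (g x * g y * g z)
      ≤ ∑ x, ∑ y, ∑ z, T x y z * (m x y + m y z + m z x) :=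
        Finset.sum_le_sum fun x _ => Finset.sum_le_sum fun y _ => Finset.sum_le_sum fun z _ =>
          mul_le_mul_of_nonneg_left (mul_mul_le_sum_mul_min (hg x) (hg y) (hg z))
            (mul_nonneg (mul_nonneg (h.nonneg x y) (h.nonneg y z)) (h.nonneg z x))
    _ = 3 * ∑ x, ∑ y, ∑ z, T x y z * m x y := by
        simp only [mul_add, Finset.sum_add_distrib, hrot', hrot]
        ring
    _ ≤ 6 * ∑ x, ∑ y, e x y * m x y := by linarith [h.sum_triangle_mul_le hm]

lemma sq_sum_triangle_le (h : SparseKernel e n) {g : V → ℝ} (hg : ∀ x, 0 ≤ g x) :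
    (∑ x, ∑ y, ∑ z, e x y * e y z * e z x * (g x * g y * g z)) ^ 2 ≤
      108 * (∑ x, g x ^ 2) ^ 3 := by
  refine (pow_le_pow_left₀ ?_ (h.sum_triangle_le hg) 2).trans ?_
  · exact Finset.sum_nonneg fun x _ => Finset.sum_nonneg fun y _ => Finset.sum_nonneg fun z _ =>
      mul_nonneg (mul_nonneg (mul_nonneg (h.nonneg x y) (h.nonneg y z)) (h.nonneg z x))
        (mul_nonneg (mul_nonneg (hg x) (hg y)) (hg z))
  · rw [mul_pow]
    linarith [h.sq_sum_mul_mul_min_le hg]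

end SparseKernel

lemma sum_fin_succ_arrow {V : Type*} [Fintype V] {m : ℕ} (φ : (Fin (m + 1) → V) → ℝ) :
    ∑ x, φ x = ∑ v, ∑ y : Fin m → V, φ (Matrix.vecCons v y) := by
  rw [← Fintype.sum_prod_type', ← (Fin.consEquiv fun _ => V).sum_comp]
  rfl

section Weights

variable {V : Type*}

/-- The weight of the graph with a single edge. -/
def edgeWeight (e : V → V → ℝ) (x : Fin 2 → V) : ℝ := e (x 0) (x 1)

/-- The weight of the path with edges `01` and `12`. -/
def pathWeight (e : V → V → ℝ) (x : Fin 3 → V) : ℝ := e (x 0) (x 1) * e (x 1) (x 2)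

/-- The weight of the triangle. -/
def triangleWeight (e : V → V → ℝ) (x : Fin 3 → V) : ℝ :=
  e (x 0) (x 1) * e (x 1) (x 2) * e (x 2) (x 0)

/-- The weight of the kite: the triangle `012` with the tail `23`. -/
def kiteWeight (e : V → V → ℝ) (x : Fin 4 → V) : ℝ :=
  e (x 0) (x 1) * e (x 1) (x 2) * e (x 2) (x 3) * e (x 2) (x 0)

end Weights

lemma single_mem_boundedExponents_one {V : Type*} [Fintype V] (j : Fin 1) (M : ℝ) :
    Pi.single j 1 ∈ boundedExponents (fun _ : Fin 1 → V => (1 : ℝ)) M M := fun F _ hM => by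
  rw [Subsingleton.elim j 0]
  simpa [weightedForm, sum_fin_succ_arrow] using hM 0

namespace SparseKernel

variable {V : Type*} [Fintype V] {e : V → V → ℝ} {n : ℝ}

lemma pathWeight_nonneg (h : SparseKernel e n) (x : Fin 3 → V) : 0 ≤ pathWeight e x :=
  mul_nonneg (h.nonneg _ _) (h.nonneg _ _)

lemma triangleWeight_nonneg (h : SparseKernel e n) (x : Fin 3 → V) : 0 ≤ triangleWeight e x :=
  mul_nonneg (h.pathWeight_nonneg x) (h.nonneg _ _)

lemma kiteWeight_nonneg (h : SparseKernel e n) (x : Fin 4 → V) : 0 ≤ kiteWeight e x :=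
  mul_nonneg (mul_nonneg (mul_nonneg (h.nonneg _ _) (h.nonneg _ _)) (h.nonneg _ _)) (h.nonneg _ _)

section Marginals

variable {M B : ℝ}

lemma insertNth_zero_mem_edge (h : SparseKernel e n) (k : Fin 2) {a : Fin 1 → ℝ}
    (ha : a ∈ boundedExponents (fun _ : Fin 1 → V => (1 : ℝ)) M B) :
    (k.insertNth 0 a : Fin 2 → ℝ) ∈ boundedExponents (edgeWeight e) M (2 * n * B) := by
  refine insertNth_zero_mem_boundedExponents (by linarith [h.pos]) (fun y => ?_) ha
  rw [mul_one]
  fin_cases k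
  exacts [h.degree' (y 0), h.degree (y 0)]

lemma insertNth_zero_mem_triangle (h : SparseKernel e n) (k : Fin 3) {a : Fin 2 → ℝ}
    (ha : a ∈ boundedExponents (edgeWeight e) M B) :
    (k.insertNth 0 a : Fin 3 → ℝ) ∈ boundedExponents (triangleWeight e) M (2 * B) := by
  refine insertNth_zero_mem_boundedExponents zero_le_two (fun y => ?_) ha
  refine le_of_eq_of_le (Finset.sum_congr rfl fun v _ => ?_) (h.sum_mul_mul_le (y 0) (y 1))
  fin_cases k
  · change e v (y 0) * e (y 0) (y 1) * e (y 1) v = _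
    rw [h.symm v]; ring
  · change e (y 0) v * e v (y 1) * e (y 1) (y 0) = _
    rw [h.symm v, h.symm (y 1) (y 0)]
  · change e (y 0) (y 1) * e (y 1) v * e v (y 0) = _
    rw [h.symm v]; ring

lemma insertNth_first_mem_path (h : SparseKernel e n) {a : Fin 2 → ℝ}
    (ha : a ∈ boundedExponents (edgeWeight e) M B) :
    ((0 : Fin 3).insertNth 0 a : Fin 3 → ℝ) ∈ boundedExponents (pathWeight e) M (2 * n * B) := by
  refine insertNth_zero_mem_boundedExponents (by linarith [h.pos]) (fun y => ?_) ha
  change ∑ v, e v (y 0) * e (y 0) (y 1) ≤ 2 * n * e (y 0) (y 1)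
  rw [← Finset.sum_mul]
  exact mul_le_mul_of_nonneg_right (h.degree' _) (h.nonneg _ _)

lemma insertNth_last_mem_path (h : SparseKernel e n) {a : Fin 2 → ℝ}
    (ha : a ∈ boundedExponents (edgeWeight e) M B) :
    ((2 : Fin 3).insertNth 0 a : Fin 3 → ℝ) ∈ boundedExponents (pathWeight e) M (2 * n * B) := by
  refine insertNth_zero_mem_boundedExponents (by linarith [h.pos]) (fun y => ?_) ha
  change ∑ v, e (y 0) (y 1) * e (y 1) v ≤ 2 * n * e (y 0) (y 1)
  rw [← Finset.mul_sum, mul_comm]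
  exact mul_le_mul_of_nonneg_right (h.degree _) (h.nonneg _ _)

lemma insertNth_mem_kite_of_triangle (h : SparseKernel e n) {a : Fin 3 → ℝ}
    (ha : a ∈ boundedExponents (triangleWeight e) M B) :
    ((3 : Fin 4).insertNth 0 a : Fin 4 → ℝ) ∈ boundedExponents (kiteWeight e) M (2 * n * B) := by
  refine insertNth_zero_mem_boundedExponents (by linarith [h.pos]) (fun y => ?_) ha
  change ∑ v, e (y 0) (y 1) * e (y 1) (y 2) * e (y 2) v * e (y 2) (y 0) ≤
    2 * n * triangleWeight e y
  simp only [mul_right_comm _ (e (y 2) _) (e (y 2) (y 0))]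
  rw [← Finset.mul_sum, mul_comm]
  exact mul_le_mul_of_nonneg_right (h.degree _) (h.triangleWeight_nonneg y)

lemma insertNth_mem_kite_of_path (h : SparseKernel e n) {a : Fin 3 → ℝ}
    (ha : a ∈ boundedExponents (pathWeight e) M B) :
    ((1 : Fin 4).insertNth 0 a : Fin 4 → ℝ) ∈ boundedExponents (kiteWeight e) M (2 * B) := by
  refine insertNth_zero_mem_boundedExponents zero_le_two (fun y => ?_) ha
  change ∑ v, e (y 0) v * e v (y 1) * e (y 1) (y 2) * e (y 1) (y 0) ≤
    2 * (e (y 0) (y 1) * e (y 1) (y 2))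
  simp only [h.symm _ (y 1), mul_right_comm _ (e (y 1) (y 2)) (e (y 1) (y 0))]
  rw [← Finset.sum_mul, ← mul_assoc]
  refine mul_le_mul_of_nonneg_right ?_ (h.nonneg _ _)
  simpa only [h.symm (y 0) (y 1)] using h.sum_mul_mul_le (y 0) (y 1)

end Marginals

end SparseKernel

lemma mul_mul_le_sum_pow_three {p q r : ℝ} (hp : 0 ≤ p) (hq : 0 ≤ q) (hr : 0 ≤ r) :
    p * q * r ≤ p ^ 3 + q ^ 3 + r ^ 3 := by
  have hmul : p * q * r ≤ max p (max q r) ^ 3 := by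
    rw [pow_three, ← mul_assoc]
    gcongr <;> simp
  refine hmul.trans ?_
  have hp3 := pow_nonneg hp 3
  have hq3 := pow_nonneg hq 3
  have hr3 := pow_nonneg hr 3
  rcases max_choice p (max q r) with h | h
  · rw [h]; linarith
  rcases max_choice q r with h' | h' <;> rw [h, h'] <;> linarith

lemma rpow_one_third_pow_three {x : ℝ} (hx : 0 ≤ x) : (x ^ (1 / 3 : ℝ)) ^ 3 = x := by
  rw [← Real.rpow_mul_natCast hx]
  norm_num

lemma rpow_one_third_sq {x : ℝ} (hx : 0 ≤ x) : (x ^ (1 / 3 : ℝ)) ^ 2 = x ^ (2 / 3 : ℝ) := by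
  rw [← Real.rpow_mul_natCast hx]
  norm_num

lemma weightedForm_edgeWeight {V : Type*} [Fintype V] (e : V → V → ℝ) (f : Fin 2 → V → ℝ) :
    weightedForm (edgeWeight e) f = ∑ x, f 0 x * ∑ y, e x y * f 1 y := by
  simp only [weightedForm, edgeWeight, sum_fin_succ_arrow, Fin.prod_univ_two, Finset.univ_unique,
    Finset.sum_singleton, Matrix.cons_val_zero, Matrix.cons_val_one, Finset.mul_sum]
  exact Finset.sum_congr rfl fun x _ => Finset.sum_congr rfl fun y _ => mul_left_comm _ _ _

lemma weightedForm_triangleWeight {V : Type*} [Fintype V] (e : V → V → ℝ) (f : Fin 3 → V → ℝ) :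
    weightedForm (triangleWeight e) f =
      ∑ x, ∑ y, ∑ z, e x y * e y z * e z x * (f 0 x * f 1 y * f 2 z) := by
  simp only [weightedForm, triangleWeight, sum_fin_succ_arrow, Fin.prod_univ_three,
    Finset.univ_unique, Finset.sum_singleton, Matrix.cons_val]

namespace SparseKernel

variable {V : Type*} [Fintype V] {e : V → V → ℝ} {n : ℝ}

lemma sum_rpow_pow_three_le (h : SparseKernel e n) {F : V → ℝ} (hF : ∀ x, 0 ≤ F x)
    (hsum : ∑ x, F x ≤ 2 * n ^ 2) :
    ∑ z, (∑ x, e z x * F x ^ (2 / 3 : ℝ)) ^ 3 ≤ 96 * n ^ 5 := by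
  have hF' := h.sum_pow_three_le fun x => Real.rpow_nonneg (hF x) (1 / 3)
  simp only [rpow_one_third_sq (hF _), rpow_one_third_pow_three (hF _)] at hF'
  calc ∑ z, (∑ x, e z x * F x ^ (2 / 3 : ℝ)) ^ 3 ≤ 24 * n * (∑ x, F x) ^ 2 := hF'
    _ ≤ 24 * n * (2 * n ^ 2) ^ 2 := by
        have := h.pos.le
        gcongr
        exact Finset.sum_nonneg fun x _ => hF x
    _ = 96 * n ^ 5 := by ring

lemma weightedForm_pathWeight (h : SparseKernel e n) (f : Fin 3 → V → ℝ) :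
    weightedForm (pathWeight e) f = ∑ y, f 1 y * (∑ x, e y x * f 0 x) * ∑ z, e y z * f 2 z := by
  simp only [weightedForm, pathWeight, sum_fin_succ_arrow, Fin.prod_univ_three,
    Finset.univ_unique, Finset.sum_singleton, Matrix.cons_val]
  rw [Finset.sum_comm]
  simp only [Finset.mul_sum, Finset.sum_mul]
  refine Finset.sum_congr rfl fun y _ => ?_
  rw [Finset.sum_comm]
  refine Finset.sum_congr rfl fun z _ => Finset.sum_congr rfl fun x _ => ?_
  rw [h.symm x y]
  ring

lemma two_thirds_mem_edge (h : SparseKernel e n) :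
    (fun _ => 2 / 3) ∈ boundedExponents (edgeWeight e) (2 * n ^ 2) (100 * n ^ 3) := by
  intro F hF hM
  have hn := h.pos
  have hF0 : ∀ j x, 0 ≤ F j x := fun j x => zero_le_one.trans (hF j x)
  set A : V → ℝ := fun x => ∑ y, e x y * F 1 y ^ (2 / 3 : ℝ)
  have hA0 : ∀ x, 0 ≤ A x := fun x =>
    Finset.sum_nonneg fun y _ => mul_nonneg (h.nonneg x y) (Real.rpow_nonneg (hF0 1 y) _)
  calc weightedForm (edgeWeight e) (fun j x => F j x ^ (2 / 3 : ℝ))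
      = ∑ x, F 0 x ^ (2 / 3 : ℝ) * A x :=
        weightedForm_edgeWeight e _
    _ ≤ ∑ x, n * (F 0 x + F 0 x + (A x / n) ^ 3) := by
        refine Finset.sum_le_sum fun x _ => ?_
        have hroot : 0 ≤ F 0 x ^ (1 / 3 : ℝ) := Real.rpow_nonneg (hF0 0 x) _
        have hamgm := mul_mul_le_sum_pow_three hroot hroot (div_nonneg (hA0 x) hn.le)
        rw [rpow_one_third_pow_three (hF0 0 x)] at hamgm
        calc F 0 x ^ (2 / 3 : ℝ) * A x
            = n * (F 0 x ^ (1 / 3 : ℝ) * F 0 x ^ (1 / 3 : ℝ) * (A x / n)) := by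
              rw [← rpow_one_third_sq (hF0 0 x)]
              field_simp
          _ ≤ n * (F 0 x + F 0 x + (A x / n) ^ 3) := mul_le_mul_of_nonneg_left hamgm hn.le
    _ = n * (∑ x, F 0 x + ∑ x, F 0 x + (∑ x, A x ^ 3) / n ^ 3) := by
        simp only [div_pow, ← Finset.mul_sum, Finset.sum_add_distrib, ← Finset.sum_div]
    _ ≤ n * (2 * n ^ 2 + 2 * n ^ 2 + 96 * n ^ 5 / n ^ 3) := by
        gcongr
        exacts [hM 0, hM 0, h.sum_rpow_pow_three_le (hF0 1) (hM 1)]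
    _ = 100 * n ^ 3 := by field_simp; ring

lemma two_thirds_third_two_thirds_mem_path (h : SparseKernel e n) :
    ![2 / 3, 1 / 3, 2 / 3] ∈ boundedExponents (pathWeight e) (2 * n ^ 2) (194 * n ^ 4) := by
  intro F hF hM
  have hn := h.pos
  have hF0 : ∀ j x, 0 ≤ F j x := fun j x => zero_le_one.trans (hF j x)
  set A : Fin 3 → V → ℝ := fun j y => ∑ x, e y x * F j x ^ (2 / 3 : ℝ)
  have hA0 : ∀ j x, 0 ≤ A j x := fun j x =>
    Finset.sum_nonneg fun y _ => mul_nonneg (h.nonneg x y) (Real.rpow_nonneg (hF0 j y) _)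
  calc weightedForm (pathWeight e) (fun j x => F j x ^ (![2 / 3, 1 / 3, 2 / 3] : Fin 3 → ℝ) j)
      = ∑ y, F 1 y ^ (1 / 3 : ℝ) * A 0 y * A 2 y :=
        h.weightedForm_pathWeight _
    _ ≤ ∑ y, n ^ 2 * (F 1 y + (A 0 y / n) ^ 3 + (A 2 y / n) ^ 3) := by
        refine Finset.sum_le_sum fun y _ => ?_
        have hamgm := mul_mul_le_sum_pow_three (Real.rpow_nonneg (hF0 1 y) (1 / 3))
          (div_nonneg (hA0 0 y) hn.le) (div_nonneg (hA0 2 y) hn.le)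
        rw [rpow_one_third_pow_three (hF0 1 y)] at hamgm
        calc F 1 y ^ (1 / 3 : ℝ) * A 0 y * A 2 y
            = n ^ 2 * (F 1 y ^ (1 / 3 : ℝ) * (A 0 y / n) * (A 2 y / n)) := by field_simp
          _ ≤ n ^ 2 * (F 1 y + (A 0 y / n) ^ 3 + (A 2 y / n) ^ 3) :=
              mul_le_mul_of_nonneg_left hamgm (sq_nonneg n)
    _ = n ^ 2 * (∑ y, F 1 y + (∑ y, A 0 y ^ 3) / n ^ 3 + (∑ y, A 2 y ^ 3) / n ^ 3) := by
        simp only [div_pow, ← Finset.mul_sum, Finset.sum_add_distrib, ← Finset.sum_div]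
    _ ≤ n ^ 2 * (2 * n ^ 2 + 96 * n ^ 5 / n ^ 3 + 96 * n ^ 5 / n ^ 3) := by
        gcongr
        exacts [hM 1, h.sum_rpow_pow_three_le (hF0 0) (hM 0),
          h.sum_rpow_pow_three_le (hF0 2) (hM 2)]
    _ = 194 * n ^ 4 := by field_simp; ring

lemma half_mem_triangle (h : SparseKernel e n) :
    (fun _ => 1 / 2) ∈ boundedExponents (triangleWeight e) (2 * n ^ 2) (200 * n ^ 3) := by
  intro F hF hM
  have hn := h.pos
  have hF0 : ∀ j x, 0 ≤ F j x := fun j x => zero_le_one.trans (hF j x)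
  set g : V → ℝ := fun x => √(∑ j, F j x)
  have hg0 : ∀ x, 0 ≤ g x := fun x => Real.sqrt_nonneg _
  have hg : ∀ j x, F j x ^ (1 / 2 : ℝ) ≤ g x := by
    intro j x
    rw [← Real.sqrt_eq_rpow]
    exact Real.sqrt_le_sqrt
      (Finset.single_le_sum (f := fun j => F j x) (fun i _ => hF0 i x) (Finset.mem_univ j))
  have hgsum : ∑ x, g x ^ 2 ≤ 6 * n ^ 2 := by
    simp only [g, Real.sq_sqrt (Finset.sum_nonneg fun j _ => hF0 j _)]
    rw [Finset.sum_comm, Fin.sum_univ_three]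
    linarith [hM 0, hM 1, hM 2]
  calc weightedForm (triangleWeight e) (fun j x => F j x ^ (1 / 2 : ℝ))
      ≤ weightedForm (triangleWeight e) fun _ => g :=
        weightedForm_mono h.triangleWeight_nonneg (fun j x => Real.rpow_nonneg (hF0 j x) _) hg
    _ = ∑ x, ∑ y, ∑ z, e x y * e y z * e z x * (g x * g y * g z) :=
        weightedForm_triangleWeight e _
    _ ≤ 200 * n ^ 3 := by
        refine abs_le_of_sq_le_sq' ?_ (by positivity) |>.2
        calc (∑ x, ∑ y, ∑ z, e x y * e y z * e z x * (g x * g y * g z)) ^ 2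
            ≤ 108 * (∑ x, g x ^ 2) ^ 3 := h.sq_sum_triangle_le hg0
          _ ≤ 108 * (6 * n ^ 2) ^ 3 := by gcongr
          _ ≤ (200 * n ^ 3) ^ 2 := by nlinarith [pow_pos hn 6]

end SparseKernel

lemma insertNth_zero_const {m : ℕ} (i : Fin (m + 1)) (c : ℝ) :
    (i.insertNth 0 (fun _ => c) : Fin (m + 1) → ℝ) = Function.update (fun _ => c) i 0 :=
  Fin.insertNth_eq_iff.2 ⟨by simp, funext fun j => by simp [Fin.removeNth]⟩

lemma insertNth_zero_single {m : ℕ} (i : Fin (m + 1)) (k : Fin m) :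
    (i.insertNth 0 (Pi.single k 1) : Fin (m + 1) → ℝ) = Pi.single (i.succAbove k) 1 :=
  Fin.insertNth_eq_iff.2 ⟨by simp, funext fun j => by simp [Fin.removeNth, Pi.single_apply]⟩

namespace SparseKernel

variable {V : Type*} [Fintype V] {e : V → V → ℝ} {n : ℝ}

lemma single_mem_edge (h : SparseKernel e n) (k : Fin 2) :
    Pi.single k 1 ∈ boundedExponents (edgeWeight e) (2 * n ^ 2) (4 * n ^ 3) := by
  obtain ⟨j, hj⟩ := Fin.exists_succAbove_eq (show k ≠ k + 1 by grind)
  rw [← hj, ← insertNth_zero_single, show 4 * n ^ 3 = 2 * n * (2 * n ^ 2) by ring]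
  exact h.insertNth_zero_mem_edge _ (single_mem_boundedExponents_one j _)

lemma mem_triangle (h : SparseKernel e n) {a : Fin 3 → ℝ} (ha : ∀ i, 0 ≤ a i)
    (hsum : ∀ i, a i + ∑ j, a j ≤ 2) :
    a ∈ boundedExponents (triangleWeight e) (2 * n ^ 2) (200 * n ^ 3) := by
  have hn3 := pow_pos h.pos 3
  have hsingle : ∀ k, Pi.single k 1 ∈
      boundedExponents (triangleWeight e) (2 * n ^ 2) (200 * n ^ 3) := by
    intro k
    obtain ⟨j, hj⟩ := Fin.exists_succAbove_eq (show k ≠ k + 1 by grind)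
    rw [← hj, ← insertNth_zero_single]
    exact boundedExponents_mono _ _ (by linarith)
      (h.insertNth_zero_mem_triangle _ (h.single_mem_edge j))
  have hedge : ∀ i, Function.update (fun _ => 2 / 3) i 0 ∈
      boundedExponents (triangleWeight e) (2 * n ^ 2) (200 * n ^ 3) := by
    intro i
    rw [← insertNth_zero_const]
    exact boundedExponents_mono _ _ (by linarith)
      (h.insertNth_zero_mem_triangle i h.two_thirds_mem_edge)
  have hzero := isLowerSet_boundedExponents h.triangleWeight_nonneg _ _
    (Pi.single_nonneg.2 zero_le_one) (hsingle 0)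
  exact mem_of_add_sum_le_two (convex_boundedExponents h.triangleWeight_nonneg _ _) hzero hsingle
    hedge h.half_mem_triangle ha hsum

lemma mem_path (h : SparseKernel e n) {a : Fin 3 → ℝ} (ha : ∀ i, 0 ≤ a i)
    (hsum : ∀ i, a i + ∑ j, a j ≤ 2) :
    a ∈ boundedExponents (pathWeight e) (2 * n ^ 2) (200 * n ^ 4) := by
  have hn4 := pow_pos h.pos 4
  set G := boundedExponents (pathWeight e) (2 * n ^ 2) (200 * n ^ 4)
  have hconv : Convex ℝ G := convex_boundedExponents h.pathWeight_nonneg _ _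
  have hlower : IsLowerSet G := isLowerSet_boundedExponents h.pathWeight_nonneg _ _
  have hhinge : ![2 / 3, 1 / 3, 2 / 3] ∈ G :=
    boundedExponents_mono _ _ (by linarith) h.two_thirds_third_two_thirds_mem_path
  have hsingle : ∀ k, Pi.single k 1 ∈ G := by
    intro k
    by_cases hk : k = 0
    · rw [hk, show (0 : Fin 3) = (2 : Fin 3).succAbove 0 from rfl, ← insertNth_zero_single]
      exact boundedExponents_mono _ _ (by linarith)
        (h.insertNth_last_mem_path (h.single_mem_edge 0))
    · obtain ⟨j, hj⟩ := Fin.exists_succAbove_eq hk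
      rw [← hj, ← insertNth_zero_single]
      exact boundedExponents_mono _ _ (by linarith)
        (h.insertNth_first_mem_path (h.single_mem_edge j))
  have hedge : ∀ i, Function.update (fun _ => 2 / 3) i 0 ∈ G := by
    intro i
    by_cases hi : i = 1
    · exact hlower (fun j => by fin_cases j <;> simp [hi]) hhinge
    · rw [← insertNth_zero_const]
      refine boundedExponents_mono _ _ (show 2 * n * (100 * n ^ 3) ≤ _ by linarith) ?_
      fin_cases i
      exacts [h.insertNth_first_mem_path h.two_thirds_mem_edge, (hi rfl).elim,
        h.insertNth_last_mem_path h.two_thirds_mem_edge]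
  have hhalf : (fun _ => 1 / 2) ∈ G := by
    convert hconv hhinge (hsingle 1) (show (0 : ℝ) ≤ 3 / 4 by norm_num)
      (show (0 : ℝ) ≤ 1 / 4 by norm_num) (by norm_num) using 1
    ext i; fin_cases i <;> simp <;> norm_num
  exact mem_of_add_sum_le_two hconv (hlower (Pi.single_nonneg.2 zero_le_one) (hsingle 0)) hsingle
    hedge hhalf ha hsum

/-- The point `a` is a convex combination of two points with the sum of the exponents of the
vertices `1` and `3` moved to one of them; these points come from the triangle and from the path
`0`-`2`-`3`. -/
lemma mem_kite (h : SparseKernel e n) {a : Fin 4 → ℝ} (ha : ∀ i, 0 ≤ a i)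
    (h0 : a 0 + ∑ j, a j ≤ 2) (h2 : a 2 + ∑ j, a j ≤ 2) (h13 : a 1 + a 3 + ∑ j, a j ≤ 2) :
    a ∈ boundedExponents (kiteWeight e) (2 * n ^ 2) (400 * n ^ 4) := by
  set s := a 1 + a 3 with hs
  have hs0 : 0 ≤ s := add_nonneg (ha 1) (ha 3)
  rw [Fin.sum_univ_four] at h0 h2 h13
  have htriangle : ![a 0, s, a 2, 0] ∈
      boundedExponents (kiteWeight e) (2 * n ^ 2) (400 * n ^ 4) := by
    have hmem : ![a 0, s, a 2] ∈ boundedExponents (triangleWeight e) (2 * n ^ 2) (200 * n ^ 3) := by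
      refine h.mem_triangle (fun i => ?_) fun i => ?_ <;> fin_cases i <;>
        simp [Fin.sum_univ_three, ha, hs0] <;> linarith
    convert h.insertNth_mem_kite_of_triangle hmem using 1
    · congr 1; ring
    · ext i; fin_cases i <;> rfl
  have hpath : ![a 0, 0, a 2, s] ∈
      boundedExponents (kiteWeight e) (2 * n ^ 2) (400 * n ^ 4) := by
    have hmem : ![a 0, a 2, s] ∈ boundedExponents (pathWeight e) (2 * n ^ 2) (200 * n ^ 4) := by
      refine h.mem_path (fun i => ?_) fun i => ?_ <;> fin_cases i <;>
        simp [Fin.sum_univ_three, ha, hs0] <;> linarith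
    convert h.insertNth_mem_kite_of_path hmem using 1
    · congr 1; ring
    · ext i; fin_cases i <;> rfl
  rcases hs0.eq_or_lt with hs0 | hs0
  · convert htriangle using 1
    ext i; fin_cases i <;> simp <;> linarith [ha 1, ha 3]
  · convert convex_boundedExponents h.kiteWeight_nonneg _ _ htriangle hpath
      (div_nonneg (ha 1) hs0.le) (div_nonneg (ha 3) hs0.le)
      (by rw [← add_div, ← hs, div_self hs0.ne']) using 1
    ext i; fin_cases i <;> simp <;> field_simp <;> rw [hs]

lemma mem_kite_of_le (h : SparseKernel e n) (hn : 1 ≤ n) {a : Fin 4 → ℝ} (ha : ∀ i, 0 ≤ a i)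
    {L : ℝ} (hL : 2 ≤ L) (h0 : a 0 + ∑ j, a j ≤ L) (h2 : a 2 + ∑ j, a j ≤ L)
    (h13 : a 1 + a 3 + ∑ j, a j ≤ L) :
    a ∈ boundedExponents (kiteWeight e) (2 * n ^ 2) (400 * n ^ 4 * (2 * n ^ 2) ^ (L - 2)) := by
  have hL0 : 0 < L := zero_lt_two.trans_le hL
  have hscale : ∀ x ≤ L, 2 / L * x ≤ 2 := fun x hx => by
    rw [div_mul_eq_mul_div, div_le_iff₀ hL0]
    exact mul_le_mul_of_nonneg_left hx zero_le_two
  have hrest : 0 ≤ 1 - 2 / L := sub_nonneg.2 ((div_le_one hL0).2 hL)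
  have hscaled : (2 / L) • a ∈ boundedExponents (kiteWeight e) (2 * n ^ 2) (400 * n ^ 4) := by
    refine h.mem_kite (fun i => mul_nonneg (by positivity) (ha i)) ?_ ?_ ?_ <;>
      simp only [Pi.smul_apply, smul_eq_mul, ← Finset.mul_sum, ← mul_add]
    exacts [hscale _ h0, hscale _ h2, hscale _ h13]
  have hsum : ∑ j, ((1 - 2 / L) • a) j ≤ L - 2 := by
    calc ∑ j, ((1 - 2 / L) • a) j = (1 - 2 / L) * ∑ j, a j := by
          simp only [Pi.smul_apply, smul_eq_mul, Finset.mul_sum]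
      _ ≤ (1 - 2 / L) * L := mul_le_mul_of_nonneg_left (by linarith [ha 0]) hrest
      _ = L - 2 := by field_simp
  have hadd := add_mem_boundedExponents h.kiteWeight_nonneg (by positivity) hscaled
    (c := (1 - 2 / L) • a) fun j => mul_nonneg hrest (ha j)
  rw [← add_smul, add_sub_cancel, one_smul] at hadd
  refine boundedExponents_mono _ _ ?_ hadd
  gcongr
  nlinarith

end SparseKernel

/-! ### Norms on the plane -/

lemma sum_indicator_one {α : Type*} [Fintype α] (s : Set α) :
    ∑ x, s.indicator (1 : α → ℝ) x = s.ncard := by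
  classical
  simp [Set.indicator_apply, Set.ncard_eq_toFinset_card', Set.toFinset]

section Norms

variable {K : Type*} [Fintype K] {p : ℝ≥0∞}

lemma card_plane : (Fintype.card (Plane K) : ℝ) = (Fintype.card K : ℝ) ^ 2 := by simp

lemma sum_abs_rpow_eq [Nonempty K] (hp : p ≠ 0) (hp' : p ≠ ∞) (f : Plane K → ℝ) :
    ∑ x, |f x| ^ p.toReal = (Fintype.card K : ℝ) ^ 2 * normL p f ^ p.toReal := by
  have hsum : 0 ≤ ∑ x, |f x| ^ p.toReal :=
    Finset.sum_nonneg fun x _ => Real.rpow_nonneg (abs_nonneg _) _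
  rw [normL, if_neg hp', one_div, Real.rpow_inv_rpow (mul_nonneg (by positivity) hsum)
    (ENNReal.toReal_ne_zero.2 ⟨hp, hp'⟩), mul_inv_cancel_left₀ (by simp)]

lemma le_normL_top (f : Plane K → ℝ) (x : Plane K) : f x ≤ normL ∞ f := by
  rw [normL, if_pos rfl]
  exact (le_abs_self _).trans (le_ciSup (Set.finite_range fun x => |f x|).bddAbove x)

lemma exists_le_normL_mul_rpow [Nonempty K] (hp : p ≠ 0) {f : Plane K → ℝ} (hf : ∀ x, 0 ≤ f x) :
    ∃ g : Plane K → ℝ, (∀ x, 1 ≤ g x) ∧ ∑ x, g x ≤ 2 * (Fintype.card K : ℝ) ^ 2 ∧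
      ∀ x, f x ≤ normL p f * g x ^ p⁻¹.toReal := by
  have hone : ∑ _ : Plane K, (1 : ℝ) = (Fintype.card K : ℝ) ^ 2 := by
    rw [← card_plane, Fintype.card_eq_sum_ones, Nat.cast_sum, Nat.cast_one]
  rw [two_mul]
  rcases eq_or_ne p ∞ with rfl | hp'
  · refine ⟨1, fun _ => le_rfl, hone.trans_le (le_add_of_nonneg_left (sq_nonneg _)), fun x => ?_⟩
    simpa using le_normL_top f x
  have hr : 0 < p.toReal := ENNReal.toReal_pos hp hp'
  have hsum := sum_abs_rpow_eq hp hp' f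
  simp only [abs_of_nonneg (hf _)] at hsum
  rw [ENNReal.toReal_inv]
  set r := p.toReal
  have hfr : ∀ x, 0 ≤ f x ^ r := fun x => Real.rpow_nonneg (hf x) r
  have hNr : 0 ≤ normL p f ^ r := Real.rpow_nonneg (normL_nonneg p f) r
  refine ⟨fun x => 1 + f x ^ r / normL p f ^ r,
    fun x => le_add_of_nonneg_right (div_nonneg (hfr x) hNr), ?_, fun x => ?_⟩
  · rw [Finset.sum_add_distrib, hone, ← Finset.sum_div, hsum]
    exact add_le_add_right (div_le_of_le_mul₀ hNr (sq_nonneg _) le_rfl) _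
  rcases (normL_nonneg p f).eq_or_lt with hN | hN
  · rw [← hN, Real.zero_rpow hr.ne', mul_zero,
      Finset.sum_eq_zero_iff_of_nonneg fun x _ => hfr x] at hsum
    rw [(Real.rpow_eq_zero (hf x) hr.ne').1 (hsum x (Finset.mem_univ x)), ← hN, zero_mul]
  · rw [← div_le_iff₀' hN, Real.le_rpow_inv_iff_of_pos (div_nonneg (hf x) hN.le)
      (add_nonneg zero_le_one (div_nonneg (hfr x) hNr)) hr, Real.div_rpow (hf x) hN.le]
    exact le_add_of_nonneg_left zero_le_one

lemma weightedForm_le_mul_prod_normL [Nonempty K] {κ : Type*} [Fintype κ] [DecidableEq κ]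
    {W : (κ → Plane K) → ℝ} (hW : ∀ x, 0 ≤ W x) {p : κ → ℝ≥0∞} (hp : ∀ j, p j ≠ 0) {B : ℝ}
    (hB : (fun j => (p j)⁻¹.toReal) ∈ boundedExponents W (2 * (Fintype.card K : ℝ) ^ 2) B)
    {f : κ → Plane K → ℝ} (hf : ∀ j x, 0 ≤ f j x) :
    weightedForm W f ≤ B * ∏ j, normL (p j) (f j) := by
  choose g hg hgsum hfg using fun j => exists_le_normL_mul_rpow (hp j) (hf j)
  calc weightedForm W f
      ≤ weightedForm W (fun j x => normL (p j) (f j) * g j x ^ (p j)⁻¹.toReal) :=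
        weightedForm_mono hW hf hfg
    _ = (∏ j, normL (p j) (f j)) * weightedForm W (fun j x => g j x ^ (p j)⁻¹.toReal) :=
        weightedForm_mul W _ _
    _ ≤ (∏ j, normL (p j) (f j)) * B :=
        mul_le_mul_of_nonneg_left (hB g hg hgsum)
          (Finset.prod_nonneg fun j _ => normL_nonneg _ _)
    _ = B * ∏ j, normL (p j) (f j) := mul_comm _ _

lemma normL_indicator_le [Nonempty K] (hp : p ≠ 0) (E : Set (Plane K)) :
    normL p (E.indicator 1) ≤ (E.ncard / (Fintype.card K : ℝ) ^ 2) ^ p⁻¹.toReal := by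
  have habs : ∀ x, |E.indicator (1 : Plane K → ℝ) x| = E.indicator 1 x := fun x =>
    abs_of_nonneg (Set.indicator_nonneg (fun _ _ => zero_le_one) x)
  rcases eq_or_ne p ∞ with rfl | hp'
  · rw [normL, if_pos rfl, ENNReal.inv_top, ENNReal.toReal_zero, Real.rpow_zero]
    exact ciSup_le fun x => (habs x).trans_le (Set.indicator_le_self' (fun _ _ => zero_le_one) x)
  · have hr : p.toReal ≠ 0 := ENNReal.toReal_ne_zero.2 ⟨hp, hp'⟩
    have hsum : ∑ x, |E.indicator (1 : Plane K → ℝ) x| ^ p.toReal = E.ncard := by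
      rw [← sum_indicator_one]
      refine Finset.sum_congr rfl fun x _ => ?_
      rw [habs]
      by_cases hx : x ∈ E <;> simp [hx, hr]
    rw [normL, if_neg hp', hsum, one_div, ENNReal.toReal_inv, div_eq_inv_mul]

end Norms

/-! ### Circles over finite fields -/

section QuadraticCharacter

variable {F : Type*} [Field F] [Fintype F] [DecidableEq F]

lemma sum_comp_sq (hF : ringChar F ≠ 2) (φ : F → ℤ) :
    ∑ a, φ (a ^ 2) = ∑ u, (quadraticChar F u + 1) * φ u := by
  rw [← Finset.sum_fiberwise Finset.univ (· ^ 2)]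
  refine Finset.sum_congr rfl fun u _ => ?_
  rw [← quadraticChar_card_sqrts hF, Finset.sum_congr rfl fun a ha => by
    rw [(Finset.mem_filter.1 ha).2], Finset.sum_const, nsmul_eq_mul]
  congr 3
  ext a
  simp

lemma sum_quadraticChar_mul_sub (hF : ringChar F ≠ 2) {t : F} (ht : t ≠ 0) :
    ∑ u, quadraticChar F u * quadraticChar F (t - u) = -quadraticChar F (-1) := by
  rw [← jacobiSum_nontrivial_inv (quadraticChar_ne_one hF), (quadraticChar_isQuadratic F).inv,
    jacobiSum, ← Equiv.sum_comp (Equiv.mulLeft₀ t ht)]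
  refine Finset.sum_congr rfl fun w _ => ?_
  rw [Equiv.mulLeft₀_apply, show t - t * w = t * (1 - w) by ring, map_mul, map_mul,
    mul_mul_mul_comm, ← sq, quadraticChar_sq_one ht, one_mul]

lemma ncard_circle (hF : ringChar F ≠ 2) {t : F} (ht : t ≠ 0) :
    ((circle t).ncard : ℤ) = Fintype.card F - quadraticChar F (-1) := by
  have hsum : ∑ u, quadraticChar F (t - u) = 0 :=
    ((Equiv.subLeft t).sum_comp (quadraticChar F)).trans (quadraticChar_sum_zero hF)
  calc ((circle t).ncard : ℤ) = ∑ x : Plane F, if x 0 ^ 2 + x 1 ^ 2 = t then 1 else 0 := by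
        simp [Set.ncard_eq_toFinset_card', circle]
    _ = ∑ a : F, ∑ b : F, if a ^ 2 + b ^ 2 = t then 1 else 0 := by
        rw [← Fintype.sum_prod_type', ← (finTwoArrowEquiv F).sum_comp]
        rfl
    _ = ∑ u, (quadraticChar F u + 1) * (quadraticChar F (t - u) + 1) := by
        simp_rw [fun u : F => sum_comp_sq hF fun v => if u + v = t then 1 else 0]
        rw [sum_comp_sq hF fun u => ∑ v, (quadraticChar F v + 1) * if u + v = t then 1 else 0]
        simp [← eq_sub_iff_add_eq']
    _ = Fintype.card F - quadraticChar F (-1) := by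
        simp only [add_mul, mul_add, one_mul, mul_one, Finset.sum_add_distrib, hsum,
          quadraticChar_sum_zero hF, sum_quadraticChar_mul_sub hF ht, Finset.sum_const,
          Finset.card_univ, nsmul_eq_mul]
        ring

end QuadraticCharacter

section Circle

variable {F : Type*} [Field F] {t : F}

lemma mem_circle {x : Plane F} : x ∈ circle t ↔ x 0 ^ 2 + x 1 ^ 2 = t := Iff.rfl

lemma neg_mem_circle {x : Plane F} : -x ∈ circle t ↔ x ∈ circle t := by simp [mem_circle]

lemma zero_notMem_circle (ht : t ≠ 0) : (0 : Plane F) ∉ circle t := by simp [mem_circle, ht.symm]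

lemma circleInd_nonneg (t : F) (x : Plane F) : 0 ≤ circleInd t x :=
  Set.indicator_nonneg (fun _ _ => zero_le_one) x

lemma circleInd_of_mem {x : Plane F} (hx : x ∈ circle t) : circleInd t x = 1 :=
  Set.indicator_of_mem hx _

lemma circleInd_of_notMem {x : Plane F} (hx : x ∉ circle t) : circleInd t x = 0 :=
  Set.indicator_of_notMem hx _

lemma circleInd_neg (t : F) (x : Plane F) : circleInd t (-x) = circleInd t x :=
  Set.indicator_eq_indicator neg_mem_circle rfl

lemma circleInd_mul_circleInd (t : F) (x y : Plane F) :
    (fun z => circleInd t (x - z) * circleInd t (y - z)) =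
      {z | x - z ∈ circle t ∧ y - z ∈ circle t}.indicator 1 := by
  ext z
  by_cases hx : x - z ∈ circle t <;> by_cases hy : y - z ∈ circle t <;> simp [circleInd, hx, hy]

lemma eq_zero_of_dot_eq_zero_of_cross_eq_zero {w x : Plane F} (hw : w 0 ^ 2 + w 1 ^ 2 ≠ 0)
    (hdot : x 0 * w 0 + x 1 * w 1 = 0) (hcross : x 0 * w 1 - x 1 * w 0 = 0) : x = 0 := by
  ext j
  refine (mul_eq_zero.1 (?_ : x j * (w 0 ^ 2 + w 1 ^ 2) = 0)).resolve_right hw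
  fin_cases j
  · change x 0 * _ = 0
    linear_combination w 0 * hdot + w 1 * hcross
  · change x 1 * _ = 0
    linear_combination w 1 * hdot - w 0 * hcross

lemma eq_or_eq_sub_of_mem_circle (h2 : (2 : F) ≠ 0) (ht : t ≠ 0) {d u v : Plane F} (hd : d ≠ 0)
    (hu : u ∈ circle t) (hv : v ∈ circle t) (hud : u - d ∈ circle t) (hvd : v - d ∈ circle t) :
    v = u ∨ v = d - u := by
  simp only [mem_circle, Pi.sub_apply] at hu hv hud hvd
  have hudot : 2 * (u 0 * d 0 + u 1 * d 1) = d 0 ^ 2 + d 1 ^ 2 := by linear_combination hu - hud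
  have hvdot : 2 * (v 0 * d 0 + v 1 * d 1) = d 0 ^ 2 + d 1 ^ 2 := by linear_combination hv - hvd
  have hdot : u 0 * d 0 + u 1 * d 1 = v 0 * d 0 + v 1 * d 1 :=
    mul_left_cancel₀ h2 (hudot.trans hvdot.symm)
  have hD : d 0 ^ 2 + d 1 ^ 2 ≠ 0 := by
    intro hD
    have hud0 : u 0 * d 0 + u 1 * d 1 = 0 :=
      (mul_eq_zero.1 (hudot.trans hD)).resolve_left h2
    have hcross : u 0 * d 1 - u 1 * d 0 = 0 := pow_eq_zero_iff two_ne_zero |>.1 <| by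
      linear_combination (u 0 ^ 2 + u 1 ^ 2) * hD - (u 0 * d 0 + u 1 * d 1) * hud0
    exact hd (eq_zero_of_dot_eq_zero_of_cross_eq_zero (hu.trans_ne ht)
      (by linear_combination hud0) (by linear_combination -hcross))
  have hsq : (v 0 * d 1 - v 1 * d 0) ^ 2 = (u 0 * d 1 - u 1 * d 0) ^ 2 := by
    linear_combination (d 0 ^ 2 + d 1 ^ 2) * (hv - hu) +
      (u 0 * d 0 + u 1 * d 1 + v 0 * d 0 + v 1 * d 1) * hdot
  rcases sq_eq_sq_iff_eq_or_eq_neg.1 hsq with h | h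
  · left
    refine sub_eq_zero.1 (eq_zero_of_dot_eq_zero_of_cross_eq_zero hD ?_ ?_)
    · simp only [Pi.sub_apply]; linear_combination -hdot
    · simp only [Pi.sub_apply]; linear_combination h
  · right
    refine sub_eq_zero.1 (eq_zero_of_dot_eq_zero_of_cross_eq_zero hD ?_ ?_)
    · simp only [Pi.sub_apply]; linear_combination hudot - hdot
    · simp only [Pi.sub_apply]; linear_combination h

/-- The image of `x` under the rotation by a sixth of a full turn, where `r` is a square root
of `3`. -/
def sixthTurn (r : F) (x : Plane F) : Plane F :=
  ![(x 0 - r * x 1) / 2, (x 1 + r * x 0) / 2]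

lemma sixthTurn_mem_circle (h2 : (2 : F) ≠ 0) {r : F} (hr : 3 = r * r) {x : Plane F}
    (hx : x ∈ circle t) : sixthTurn r x ∈ circle t := by
  simp only [mem_circle, sixthTurn, Matrix.cons_val] at hx ⊢
  field_simp
  linear_combination 4 * hx - (x 0 ^ 2 + x 1 ^ 2) * hr

lemma sub_sixthTurn_mem_circle (h2 : (2 : F) ≠ 0) {r : F} (hr : 3 = r * r) {x : Plane F}
    (hx : x ∈ circle t) : x - sixthTurn r x ∈ circle t := by
  simp only [mem_circle, sixthTurn, Pi.sub_apply, Matrix.cons_val] at hx ⊢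
  field_simp
  linear_combination 4 * hx - (x 0 ^ 2 + x 1 ^ 2) * hr

/-- Twice the dot product of `x` and `y` is `t`, so that four times the square of their cross
product is `3 t ^ 2`. -/
lemma isSquare_three_of_mem_circle (ht : t ≠ 0) {x y : Plane F} (hx : x ∈ circle t)
    (hy : y ∈ circle t) (hxy : x - y ∈ circle t) : IsSquare (3 : F) := by
  simp only [mem_circle, Pi.sub_apply] at hx hy hxy
  have hdot : 2 * (x 0 * y 0 + x 1 * y 1) = t := by linear_combination hx + hy - hxy
  refine ⟨2 * (x 0 * y 1 - x 1 * y 0) / t, ?_⟩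
  field_simp
  linear_combination (-4 * t) * hx - 4 * (x 0 ^ 2 + x 1 ^ 2) * hy +
    (t + 2 * (x 0 * y 0 + x 1 * y 1)) * hdot

lemma ncard_common_neighbors_le (h2 : (2 : F) ≠ 0) (ht : t ≠ 0) {x y : Plane F} (hxy : x ≠ y) :
    {z | x - z ∈ circle t ∧ y - z ∈ circle t}.ncard ≤ 2 := by
  rcases Set.eq_empty_or_nonempty {z | x - z ∈ circle t ∧ y - z ∈ circle t} with
    hempty | ⟨z₀, hxz₀, hyz₀⟩
  · simp [hempty]
  refine (Set.ncard_le_ncard (t := {z₀, x + y - z₀}) ?_).trans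
    ((Set.ncard_insert_le _ _).trans_eq (by rw [Set.ncard_singleton]))
  rintro z ⟨hxz, hyz⟩
  refine (eq_or_eq_sub_of_mem_circle h2 ht (sub_ne_zero.2 hxy) hxz₀ hxz
    (by rwa [sub_sub_sub_cancel_left]) (by rwa [sub_sub_sub_cancel_left])).imp
    (fun h => sub_right_inj.1 h) fun h => ?_
  exact (show z = x + y - z₀ by linear_combination -h)

end Circle

section FiniteField

variable {F : Type*} [Field F] [Fintype F] {t : F}

lemma ringChar_ne_two_of_odd_card (hodd : Odd (Fintype.card F)) : ringChar F ≠ 2 := fun h =>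
  Nat.not_even_iff_odd.2 hodd (Nat.even_iff.2 (FiniteField.even_card_of_char_two h))

lemma three_le_card (hodd : Odd (Fintype.card F)) : 3 ≤ Fintype.card F := by
  obtain ⟨k, hk⟩ := hodd
  have := Fintype.one_lt_card (α := F)
  lia

lemma ncard_circle_bounds (hodd : Odd (Fintype.card F)) (ht : t ≠ 0) :
    (circle t).ncard ≤ Fintype.card F + 1 ∧ Fintype.card F ≤ (circle t).ncard + 1 := by
  classical
  have hcard := ncard_circle (ringChar_ne_two_of_odd_card hodd) ht
  rcases quadraticChar_dichotomy (neg_ne_zero.2 (one_ne_zero (α := F))) with h | h <;>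
    rw [h] at hcard <;> lia

lemma ncard_circle_le (hodd : Odd (Fintype.card F)) (ht : t ≠ 0) :
    ((circle t).ncard : ℝ) ≤ 2 * Fintype.card F := by
  have := (ncard_circle_bounds hodd ht).1
  have := three_le_card hodd
  exact_mod_cast (by lia : (circle t).ncard ≤ 2 * Fintype.card F)

lemma card_le_two_mul_ncard_circle (hodd : Odd (Fintype.card F)) (ht : t ≠ 0) :
    (Fintype.card F : ℝ) ≤ 2 * (circle t).ncard := by
  have := (ncard_circle_bounds hodd ht).2
  have := three_le_card hodd
  exact_mod_cast (by lia : Fintype.card F ≤ 2 * (circle t).ncard)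

lemma sparseKernel_circleInd (hodd : Odd (Fintype.card F)) (ht : t ≠ 0) :
    SparseKernel (fun x y => circleInd t (x - y)) (Fintype.card F) where
  pos := by exact_mod_cast Fintype.card_pos
  nonneg _ _ := circleInd_nonneg _ _
  le_one _ _ := Set.indicator_le_self' (fun _ _ => zero_le_one) _
  symm x y := by
    rw [← neg_sub, circleInd_neg]
  self x := by
    rw [sub_self]
    exact circleInd_of_notMem (zero_notMem_circle ht)
  degree x := ((Equiv.subLeft x).sum_comp (circleInd t)).trans_le <|
    (sum_indicator_one _).trans_le (ncard_circle_le hodd ht)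
  codegree x y hxy := by
    rw [circleInd_mul_circleInd, sum_indicator_one]
    exact_mod_cast ncard_common_neighbors_le
      (Ring.two_ne_zero (ringChar_ne_two_of_odd_card hodd)) ht hxy

end FiniteField

/-! ### Diamonds and kites over circles -/

section Forms

/-- The weight of the diamond: the 4-cycle `0123` with the diagonal `02`. -/
def diamondWeight {V : Type*} (e : V → V → ℝ) (x : Fin 4 → V) : ℝ :=
  e (x 0) (x 1) * e (x 1) (x 2) * e (x 2) (x 3) * e (x 3) (x 0) * e (x 0) (x 2)

lemma SparseKernel.diamondWeight_nonneg {V : Type*} [Fintype V] {e : V → V → ℝ} {n : ℝ}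
    (h : SparseKernel e n) (x : Fin 4 → V) : 0 ≤ diamondWeight e x :=
  mul_nonneg (mul_nonneg (mul_nonneg (mul_nonneg (h.nonneg _ _) (h.nonneg _ _)) (h.nonneg _ _))
    (h.nonneg _ _)) (h.nonneg _ _)

variable {F : Type*} [Field F] [Fintype F] {t : F} {p : Fin 4 → ℝ≥0∞}

lemma diamondForm_eq (t : F) (f : Fin 4 → Plane F → ℝ) :
    diamondForm t f = 1 / ((Fintype.card F : ℝ) ^ 2 * (circle t).ncard) *
      weightedForm (diamondWeight fun x y => circleInd t (x - y)) f := by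
  simp only [weightedForm, sum_fin_succ_arrow (V := Plane F), Fin.prod_univ_four,
    Fintype.sum_unique]
  rfl

lemma kiteForm_eq (t : F) (f : Fin 4 → Plane F → ℝ) :
    kiteForm t f = 1 / ((Fintype.card F : ℝ) ^ 2 * (circle t).ncard ^ 2) *
      weightedForm (kiteWeight fun x y => circleInd t (x - y)) f := by
  simp only [weightedForm, sum_fin_succ_arrow (V := Plane F), Fin.prod_univ_four,
    Fintype.sum_unique]
  rfl

lemma strongBound_kiteForm_of_mem (hodd : Odd (Fintype.card F)) (ht : t ≠ 0)
    (hp : ∀ j, p j ≠ 0) {B : ℝ≥0}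
    (hB : (fun j => (p j)⁻¹.toReal) ∈ boundedExponents
      (kiteWeight fun x y => circleInd t (x - y)) (2 * (Fintype.card F : ℝ) ^ 2)
      (B * (Fintype.card F : ℝ) ^ 4)) :
    StrongBound (kiteForm t) p (4 * B) := by
  intro f hf
  have hq : (0 : ℝ) < Fintype.card F := by exact_mod_cast Fintype.card_pos
  have hN := card_le_two_mul_ncard_circle hodd ht
  have hform := weightedForm_le_mul_prod_normL
    (sparseKernel_circleInd hodd ht).kiteWeight_nonneg hp hB hf
  have hP : 0 ≤ ∏ j, normL (p j) (f j) := Finset.prod_nonneg fun j _ => normL_nonneg _ _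
  rw [kiteForm_eq]
  set q : ℝ := (Fintype.card F : ℝ)
  set N : ℝ := ((circle t).ncard : ℝ)
  set P := ∏ j, normL (p j) (f j)
  have hN0 : 0 < N := by linarith
  rw [one_div, inv_mul_le_iff₀ (by positivity), NNReal.coe_mul, NNReal.coe_ofNat]
  calc _ ≤ B * q ^ 4 * P := hform
    _ = B * P * q ^ 2 * q ^ 2 := by ring
    _ ≤ B * P * q ^ 2 * (2 * N) ^ 2 := by gcongr
    _ = q ^ 2 * N ^ 2 * (4 * B * P) := by ring

lemma strongBound_kiteForm (hodd : Odd (Fintype.card F)) (ht : t ≠ 0) (hp : ∀ j, p j ≠ 0)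
    {L : ℝ} (hL : 2 ≤ L) {a : Fin 4 → ℝ} (ha : a = fun j => (p j)⁻¹.toReal)
    (h0 : a 0 + ∑ j, a j ≤ L) (h2 : a 2 + ∑ j, a j ≤ L) (h13 : a 1 + a 3 + ∑ j, a j ≤ L)
    {B : ℝ≥0} (hB : (2 * (Fintype.card F : ℝ) ^ 2) ^ (L - 2) ≤ B) :
    StrongBound (kiteForm t) p (1600 * B) := by
  have hmem := (sparseKernel_circleInd hodd ht).mem_kite_of_le (mod_cast Fintype.card_pos)
    (fun j => ha ▸ ENNReal.toReal_nonneg) hL h0 h2 h13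
  rw [ha] at hmem
  rw [show 1600 * B = 4 * (400 * B) by ring]
  refine strongBound_kiteForm_of_mem hodd ht hp (boundedExponents_mono _ _ ?_ hmem)
  rw [NNReal.coe_mul, NNReal.coe_ofNat, mul_right_comm]
  gcongr

lemma StrongBound.restrictedBound {K : Type*} [Fintype K] {Λ : (Fin 4 → Plane K → ℝ) → ℝ}
    {C : ℝ≥0} (h : StrongBound Λ p C) : RestrictedBound Λ p C := fun _ =>
  h _ fun _ _ => Set.indicator_nonneg (fun _ _ => zero_le_one) _

lemma kiteForm_eq_zero (ht : t ≠ 0) (h3 : ¬ IsSquare (3 : F)) (f : Fin 4 → Plane F → ℝ) :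
    kiteForm t f = 0 := by
  rw [kiteForm_eq, weightedForm, Finset.sum_eq_zero, mul_zero]
  intro x _
  by_contra hne
  have hmem : ∀ {z : Plane F}, circleInd t z ≠ 0 → z ∈ circle t := Set.mem_of_indicator_ne_zero
  simp only [kiteWeight, mul_ne_zero_iff, ne_eq] at hne
  obtain ⟨⟨⟨⟨h01, h12⟩, -⟩, h20⟩, -⟩ := hne
  have h02 : x 0 - x 2 ∈ circle t := by
    rw [← neg_mem_circle, neg_sub]
    exact hmem h20
  refine h3 (isSquare_three_of_mem_circle ht (hmem h01) h02 ?_)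
  rw [sub_sub_sub_cancel_left, ← neg_mem_circle, neg_sub]
  exact hmem h12

end Forms

section Test

variable {F : Type*} [Field F] {t : F}

/-- The sets on which the diamond form is tested: the point `0` at the vertices of `S`, and the
circle at the others. -/
def testSet (t : F) (S : Finset (Fin 4)) (j : Fin 4) : Set (Plane F) :=
  if j ∈ S then {0} else circle t

variable [Fintype F] {p : Fin 4 → ℝ≥0∞} {C : ℝ≥0}

lemma normL_testSet_le (hodd : Odd (Fintype.card F)) (ht : t ≠ 0) {p : ℝ≥0∞} (hp : p ≠ 0)
    (S : Finset (Fin 4)) (j : Fin 4) :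
    normL p ((testSet t S j).indicator 1) ≤
      ((2 : ℝ) / Fintype.card F) ^ (p⁻¹.toReal + if j ∈ S then p⁻¹.toReal else 0) := by
  have hq : (0 : ℝ) < Fintype.card F := by exact_mod_cast Fintype.card_pos
  have ha : 0 ≤ p⁻¹.toReal := ENNReal.toReal_nonneg
  refine (normL_indicator_le hp _).trans ?_
  by_cases hj : j ∈ S
  · rw [testSet, if_pos hj, if_pos hj, Set.ncard_singleton, Nat.cast_one,
      Real.rpow_add (by positivity), ← Real.mul_rpow (by positivity) (by positivity)]
    refine Real.rpow_le_rpow (by positivity) ?_ ha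
    rw [div_mul_div_comm, ← sq (Fintype.card F : ℝ)]
    gcongr
    norm_num
  · rw [testSet, if_neg hj, if_neg hj, add_zero]
    refine Real.rpow_le_rpow (by positivity) ?_ ha
    rw [div_le_div_iff₀ (by positivity) hq]
    nlinarith [ncard_circle_le hodd ht]

lemma inv_sq_le_diamondForm_testSet (hodd : Odd (Fintype.card F)) (ht : t ≠ 0)
    {S : Finset (Fin 4)} {c : Plane F → Fin 4 → Plane F} (hc : Function.Injective c)
    (hS : ∀ s ∈ circle t, ∀ j, c s j ∈ testSet t S j)
    (hW : ∀ s ∈ circle t, diamondWeight (fun x y => circleInd t (x - y)) (c s) = 1) :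
    ((Fintype.card F : ℝ) ^ 2)⁻¹ ≤ diamondForm t fun j => (testSet t S j).indicator 1 := by
  classical
  have hq : (0 : ℝ) < Fintype.card F := by exact_mod_cast Fintype.card_pos
  have hN : (0 : ℝ) < (circle t).ncard := by linarith [card_le_two_mul_ncard_circle hodd ht]
  have hcount := card_le_weightedForm_indicator
    (sparseKernel_circleInd hodd ht).diamondWeight_nonneg (testSet t S)
    ((circle t).toFinset.map ⟨c, hc⟩) (by simpa using fun s hs => ⟨(hW s hs).ge, hS s hs⟩)
  rw [Finset.card_map, ← Set.ncard_eq_toFinset_card'] at hcount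
  calc ((Fintype.card F : ℝ) ^ 2)⁻¹
      = 1 / ((Fintype.card F : ℝ) ^ 2 * (circle t).ncard) * (circle t).ncard := by field_simp
    _ ≤ _ := by rw [diamondForm_eq]; gcongr

lemma half_card_rpow_le_of_testSet (hodd : Odd (Fintype.card F)) (ht : t ≠ 0)
    (hp : ∀ j, p j ≠ 0) (hC : StrongBound (diamondForm t) p C) {S : Finset (Fin 4)}
    (hS : ((Fintype.card F : ℝ) ^ 2)⁻¹ ≤ diamondForm t fun j => (testSet t S j).indicator 1) :
    ((Fintype.card F : ℝ) / 2) ^ (∑ j ∈ S, (p j)⁻¹.toReal + ∑ j, (p j)⁻¹.toReal - 2) ≤ 4 * C := by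
  have hq : (0 : ℝ) < Fintype.card F := by exact_mod_cast Fintype.card_pos
  set q : ℝ := (Fintype.card F : ℝ)
  set L := ∑ j ∈ S, (p j)⁻¹.toReal + ∑ j, (p j)⁻¹.toReal
  have hnorm : ∏ j, normL (p j) ((testSet t S j).indicator 1) ≤ (2 / q) ^ L := by
    calc ∏ j, normL (p j) ((testSet t S j).indicator 1)
        ≤ ∏ j, (2 / q) ^ ((p j)⁻¹.toReal + if j ∈ S then (p j)⁻¹.toReal else 0) :=
          Finset.prod_le_prod (fun j _ => normL_nonneg _ _)
            fun j _ => normL_testSet_le hodd ht (hp j) S j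
      _ = (2 / q) ^ L := by
          rw [← Real.rpow_sum_of_pos (by positivity), Finset.sum_add_distrib,
            Finset.sum_ite_mem, Finset.univ_inter, add_comm]
  have hbound : (q ^ 2)⁻¹ ≤ C * (2 / q) ^ L := hS.trans <|
    (hC _ fun j _ => Set.indicator_nonneg (fun _ _ => zero_le_one) _).trans
      (mul_le_mul_of_nonneg_left hnorm C.coe_nonneg)
  calc (q / 2) ^ (L - 2) = (q / 2) ^ L * 4 * (q ^ 2)⁻¹ := by
        rw [Real.rpow_sub (by positivity), Real.rpow_two]
        field_simp
        norm_num
    _ ≤ (q / 2) ^ L * 4 * (C * (2 / q) ^ L) := by gcongr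
    _ = 4 * C * ((q / 2) * (2 / q)) ^ L := by
        rw [Real.mul_rpow (by positivity) (by positivity)]
        ring
    _ = 4 * C := by
        rw [show q / 2 * (2 / q) = 1 by field_simp, Real.one_rpow, mul_one]

/-- An equilateral triangle with vertices `0`, `s` and `sixthTurn r s` is a degenerate diamond, in
which the vertices `1` and `3` coincide. -/
lemma inv_sq_le_diamondForm (hodd : Odd (Fintype.card F)) (h3 : IsSquare (3 : F)) (ht : t ≠ 0)
    {S : Finset (Fin 4)} (hS : S = {0} ∨ S = {2} ∨ S = {1, 3}) :
    ((Fintype.card F : ℝ) ^ 2)⁻¹ ≤ diamondForm t fun j => (testSet t S j).indicator 1 := by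
  obtain ⟨r, hr⟩ := h3
  have hF := Ring.two_ne_zero (ringChar_ne_two_of_odd_card hodd)
  have hρ : ∀ s ∈ circle t, sixthTurn r s ∈ circle t := fun s => sixthTurn_mem_circle hF hr
  have hsub : ∀ s ∈ circle t, circleInd t (s - sixthTurn r s) = 1 := fun s hs =>
    circleInd_of_mem (sub_sixthTurn_mem_circle hF hr hs)
  have hsub' : ∀ s ∈ circle t, circleInd t (sixthTurn r s - s) = 1 := fun s hs => by
    rw [← neg_sub, circleInd_neg, hsub s hs]
  rcases hS with rfl | rfl | rfl
  · refine inv_sq_le_diamondForm_testSet hodd ht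
      (c := fun s => ![0, sixthTurn r s, s, sixthTurn r s])
      (fun s s' h => congrFun h 2) (fun s hs j => ?_) fun s hs => ?_
    · fin_cases j <;> simp [testSet, hs, hρ s hs]
    · simp [diamondWeight, circleInd_neg, circleInd_of_mem hs, circleInd_of_mem (hρ s hs),
        hsub s hs, hsub' s hs]
  · refine inv_sq_le_diamondForm_testSet hodd ht
      (c := fun s => ![s, sixthTurn r s, 0, sixthTurn r s])
      (fun s s' h => congrFun h 0) (fun s hs j => ?_) fun s hs => ?_
    · fin_cases j <;> simp [testSet, hs, hρ s hs]
    · simp [diamondWeight, circleInd_neg, circleInd_of_mem hs, circleInd_of_mem (hρ s hs),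
        hsub s hs, hsub' s hs]
  · refine inv_sq_le_diamondForm_testSet hodd ht
      (c := fun s => ![s, 0, sixthTurn r s, 0])
      (fun s s' h => congrFun h 0) (fun s hs j => ?_) fun s hs => ?_
    · fin_cases j <;> simp [testSet, hs, hρ s hs]
    · simp [diamondWeight, circleInd_neg, circleInd_of_mem hs, circleInd_of_mem (hρ s hs),
        hsub s hs]

lemma exists_two_le_and_half_card_rpow_le (hodd : Odd (Fintype.card F))
    (h3 : IsSquare (3 : F)) (ht : t ≠ 0) (hp : ∀ j, p j ≠ 0)
    (hC : StrongBound (diamondForm t) p C) (hC1 : 1 ≤ C) {a : Fin 4 → ℝ}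
    (ha : a = fun j => (p j)⁻¹.toReal) :
    ∃ L, 2 ≤ L ∧ a 0 + ∑ j, a j ≤ L ∧ a 2 + ∑ j, a j ≤ L ∧ a 1 + a 3 + ∑ j, a j ≤ L ∧
      ((Fintype.card F : ℝ) / 2) ^ (L - 2) ≤ 4 * C := by
  have htest : ∀ S : Finset (Fin 4), S = {0} ∨ S = {2} ∨ S = {1, 3} →
      ((Fintype.card F : ℝ) / 2) ^ (∑ j ∈ S, a j + ∑ j, a j - 2) ≤ 4 * C := fun S hS => by
    simpa only [ha] using
      half_card_rpow_le_of_testSet hodd ht hp hC (inv_sq_le_diamondForm hodd h3 ht hS)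
  have h0 := htest {0} (by simp)
  have h2 := htest {2} (by simp)
  have h13 := htest {1, 3} (by simp)
  rw [Finset.sum_singleton] at h0 h2
  rw [Finset.sum_pair (by decide)] at h13
  refine ⟨max (max 2 (a 0 + ∑ j, a j)) (max (a 2 + ∑ j, a j) (a 1 + a 3 + ∑ j, a j)),
    by simp, by simp, by simp, by simp, ?_⟩
  let P : ℝ → Prop := fun L => ((Fintype.card F : ℝ) / 2) ^ (L - 2) ≤ 4 * C
  have hP : P 2 := by
    simp only [P, sub_self, Real.rpow_zero]
    exact one_le_mul_of_one_le_of_one_le (by norm_num) (NNReal.one_le_coe.2 hC1)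
  exact max_rec' P (max_rec' P hP h0) (max_rec' P h2 h13)

/-- The loss `(2 q²) ^ (L - 2)` in the kite bound is at most the eighth power of
`(q / 2) ^ (L - 2)`. -/
lemma strongBound_kiteForm_of_strongBound_diamondForm (hodd : Odd (Fintype.card F)) (ht : t ≠ 0)
    (hp : ∀ j, p j ≠ 0) (hC1 : 1 ≤ C) (hC : StrongBound (diamondForm t) p C) :
    StrongBound (kiteForm t) p (1600 * (4 * C) ^ 8) := by
  by_cases h3 : IsSquare (3 : F)
  · obtain ⟨L, hL, h0, h2, h13, hCL⟩ := exists_two_le_and_half_card_rpow_le hodd h3 ht hp hC hC1 rfl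
    refine strongBound_kiteForm hodd ht hp hL rfl h0 h2 h13 ?_
    have hq : (3 : ℝ) ≤ Fintype.card F := by exact_mod_cast three_le_card hodd
    set q : ℝ := (Fintype.card F : ℝ)
    have hq8 : 2 * q ^ 2 ≤ (q / 2) ^ 8 := by
      calc 2 * q ^ 2 ≤ 3 ^ 6 / 2 ^ 8 * q ^ 2 := by gcongr; norm_num
        _ ≤ q ^ 6 / 2 ^ 8 * q ^ 2 := by gcongr
        _ = (q / 2) ^ 8 := by ring
    calc (2 * q ^ 2) ^ (L - 2) ≤ ((q / 2) ^ 8) ^ (L - 2) :=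
          Real.rpow_le_rpow (by positivity) hq8 (sub_nonneg.2 hL)
      _ = ((q / 2) ^ (L - 2)) ^ 8 := Real.rpow_pow_comm (by positivity) _ _ |>.symm
      _ ≤ (4 * C) ^ 8 := by gcongr
      _ = ((4 * C) ^ 8 : ℝ≥0) := by push_cast; rfl
  · intro f _
    rw [kiteForm_eq_zero ht h3]
    exact mul_nonneg (NNReal.coe_nonneg _) (Finset.prod_nonneg fun j _ => normL_nonneg _ _)

lemma strongBound_kiteForm_two_two_two_top (hodd : Odd (Fintype.card F)) (ht : t ≠ 0) :
    StrongBound (kiteForm t) ![2, 2, 2, ∞] 1600 := by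
  rw [← mul_one (1600 : ℝ≥0)]
  refine strongBound_kiteForm hodd ht (fun j => by fin_cases j <;> simp) le_rfl rfl ?_ ?_ ?_
    (by simp) <;> simp [Fin.sum_univ_four] <;> norm_num

end Test

end GraphForms

theorem theorem9p10_general {ι : Type*} (F : ι → Type*) [∀ i, Field (F i)] [∀ i, Fintype (F i)]
    (t : ∀ i, F i) (hodd : ∀ i, Odd (Fintype.card (F i))) (ht : ∀ i, t i ≠ 0) :
    (∀ p : Fin 4 → ℝ≥0∞, (∀ j, p j ≠ 0) →
      GraphForms.LesssimOne (fun i => GraphForms.bestConst (GraphForms.diamondForm (t i)) p) →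
      GraphForms.LesssimOne (fun i => GraphForms.bestConst (GraphForms.kiteForm (t i)) p)) ∧
    GraphForms.LesssimOne
      (fun i => GraphForms.bestConst (GraphForms.kiteForm (t i)) ![2, 2, 2, ∞]) := by
  refine ⟨fun p hp => ?_, 1600, by norm_num, fun i => (GraphForms.bestConst_le_iff _ _ _).2
    (GraphForms.strongBound_kiteForm_two_two_two_top (hodd i) (ht i))⟩
  rintro ⟨C, hC1, hC⟩
  have hconst : 1 ≤ 1600 * (4 * C) ^ 8 :=
    one_le_mul (by norm_num) (one_le_pow₀ (one_le_mul (by norm_num) hC1))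
  exact ⟨1600 * (4 * C) ^ 8, hconst, fun i => (GraphForms.bestConst_le_iff _ _ _).2 <|
    GraphForms.strongBound_kiteForm_of_strongBound_diamondForm (hodd i) (ht i) hp hC1 <|
      (GraphForms.bestConst_le_iff _ _ _).1 (hC i)⟩

/-- The constants are uniform over an arbitrary family of pairs `(F i, t i)`, where `F i` is a
finite field of odd order in which `3` is a square and `t i ∈ F i` is nonzero; the family of all
such pairs (in a universe) is allowed. -/
theorem theorem9p10 {ι : Type*} (F : ι → Type*) [∀ i, Field (F i)] [∀ i, Fintype (F i)]
    (t : ∀ i, F i) (hodd : ∀ i, Odd (Fintype.card (F i)))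
    (h3 : ∀ i, IsSquare (3 : F i)) (ht : ∀ i, t i ≠ 0) :
    (∀ p : Fin 4 → ℝ≥0∞, (∀ j, 1 ≤ p j) →
      GraphForms.LesssimOne (fun i => GraphForms.bestConst (GraphForms.diamondForm (t i)) p) →
      p ≠ ![2, 2, 2, ∞] →
      GraphForms.LesssimOne (fun i => GraphForms.bestConst (GraphForms.kiteForm (t i)) p)) ∧
    (∃ C : ℝ≥0, ∀ i,
      GraphForms.RestrictedBound (GraphForms.kiteForm (t i)) ![2, 2, 2, ∞] C) := by
  obtain ⟨h, C, -, hC⟩ := theorem9p10_general F t hodd ht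
  exact ⟨fun p hp hd _ => h p (fun j => (zero_lt_one.trans_le (hp j)).ne') hd, C, fun i =>
    ((GraphForms.bestConst_le_iff _ _ _).1 (hC i)).restrictedBound⟩
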